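/- Let $q,u_0,u_1\in\mathbb C^\star$ with $q^m\neq1$ for all integers $m>0$, and fix a square root $q^{1/2}$ of $q$. Let $\mathcal H_{IV}$ be the unital associative $\mathbb C$-algebra generated by $V_0,V_1,\check V_0,\check V_1$ with the relations $$V_0^2+V_0=0,\qquad V_1^2+V_1=0,\qquad \check V_0^2+u_0^{-1}\check V_0=0,\qquad (\check V_1-u_1)(\check V_1+u_1^{-1})=0,$$ $$q^{1/2}\check V_1V_1V_0=\check V_0+u_0^{-1},\qquad \check V_0\check V_1V_1=0,\qquad V_0\check V_0=0,$$ $$YX=q\,T^2XY-q\,TY-TX-q^{1/2}u_0^{-1}T,$$ where $T=\check V_1$, $X=(V_1+1)(\check V_1+u_1^{-1}-u_1)$, $Y=\check V_1V_0$; put also $W=\check V_1V_1$, $Z=(V_0+1)(\check V_1+u_1^{-1}-u_1)$. Let $\mathbb T_q$ be the quantum torus: the unital associative $\mathbb C$-algebra generated by invertible elements $e^{S_1},e^{S_2},e^{S_3}$ (with inverses $e^{-S_i}$) with relations $$e^{S_1}e^{S_2}=q^{-1}e^{S_2}e^{S_1},\quad e^{S_2}e^{S_3}=q^{-1}e^{S_3}e^{S_2},\quad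 e^{S_3}e^{S_1}=q^{-1}e^{S_1}e^{S_3},\quad e^{S_1}e^{S_2}e^{S_3}=-i\,q^{-1/2}u_0^{-1}.$$ (That is, $[S_1,S_2]=[S_2,S_3]=[S_3,S_1]=i\pi\hbar$, $q=e^{-i\pi\hbar}$, $u_0=-i\,e^{-S_1-S_2-S_3}$.) Then the assignment $$V_0\mapsto\begin{pmatrix}-1&0\\1+i\,e^{S_3}&0\end{pmatrix},\qquad V_1\mapsto\begin{pmatrix}-1-i\,e^{S_2}&-1-i\,e^{S_2}\\ i\,e^{S_2}&i\,e^{S_2}\end{pmatrix},$$ $$\check V_1\mapsto\begin{pmatrix}0&-i\,e^{S_1}\\ i\,e^{-S_1}&u_1-u_1^{-1}\end{pmatrix},\qquad \check V_0\mapsto\begin{pmatrix}0&0\\ q^{1/2}s&-u_0^{-1}\end{pmatrix},$$ $$s=e^{-S_1}e^{S_3}+(u_1^{-1}-u_1)\,e^{S_2}e^{S_3}+i\,e^{-S_1}e^{S_2}e^{S_3},$$ defines an embedding (an injective homomorphism of unital $\mathbb C$-algebras) $\mathcal H_{IV}\to \mathrm{Mat}(2,\mathbb T_q)$. In particular the four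 matrices satisfy all the relations of $\mathcal H_{IV}$. Moreover, writing $X^{(m)}=X^m$ for $m\ge0$ and $X^{(m)}=W^{-m}$ for $m<0$, and $Y^{(n)}=Y^n$ for $n\ge 0$ and $Y^{(n)}=Z^{-n}$ for $n<0$, the images of the elements $X^{(m)}T^{\varepsilon}Y^{(n)}$, $m,n\in\mathbb Z$, $\varepsilon\in\{0,1\}$, are linearly independent over $\mathbb C$. -/

import Mathlib

namespace ConfluentPIV

noncomputable section

/-! ### The quantum torus -/

/-- Generators of the quantum torus: `pos i` and `neg i` stand for `e^{S_{i+1}}` and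
`e^{-S_{i+1}}`, with `i = 0, 1, 2`. -/
inductive TorusGen : Type
  | pos (i : Fin 3)
  | neg (i : Fin 3)

/-- Relations of the quantum torus. From `[S₁,S₂] = [S₂,S₃] = [S₃,S₁] = iπħ` and
`q = e^{-iπħ}` one has `e^{S_i} e^{S_{i+1}} = q⁻¹ e^{S_{i+1}} e^{S_i}` (indices mod 3) and
`e^{S₁+S₂+S₃} = q^{1/2} e^{S₁} e^{S₂} e^{S₃}`, so that `u₀ = -i e^{-S₁-S₂-S₃}` reads
`e^{S₁} e^{S₂} e^{S₃} = -i / (q^{1/2} u₀)`. The parameter `r` is `q^{1/2}`. -/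
inductive TorusRel (q r u₀ : ℂ) :
    FreeAlgebra ℂ TorusGen → FreeAlgebra ℂ TorusGen → Prop
  | pos_neg (i : Fin 3) : TorusRel q r u₀
      (FreeAlgebra.ι ℂ (TorusGen.pos i) * FreeAlgebra.ι ℂ (TorusGen.neg i)) 1
  | neg_pos (i : Fin 3) : TorusRel q r u₀
      (FreeAlgebra.ι ℂ (TorusGen.neg i) * FreeAlgebra.ι ℂ (TorusGen.pos i)) 1
  | comm (i : Fin 3) : TorusRel q r u₀
      (FreeAlgebra.ι ℂ (TorusGen.pos i) * FreeAlgebra.ι ℂ (TorusGen.pos (i + 1)))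
      (q⁻¹ • (FreeAlgebra.ι ℂ (TorusGen.pos (i + 1)) * FreeAlgebra.ι ℂ (TorusGen.pos i)))
  | total : TorusRel q r u₀
      (FreeAlgebra.ι ℂ (TorusGen.pos 0) * FreeAlgebra.ι ℂ (TorusGen.pos 1) *
        FreeAlgebra.ι ℂ (TorusGen.pos 2))
      (algebraMap ℂ (FreeAlgebra ℂ TorusGen) (-Complex.I / (r * u₀)))

/-- The quantum torus `𝕋_q`. -/
abbrev QTorus (q r u₀ : ℂ) : Type := RingQuot (TorusRel q r u₀)

/-- `e^{S_{i+1}}` in the quantum torus. -/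
def expS (q r u₀ : ℂ) (i : Fin 3) : QTorus q r u₀ :=
  RingQuot.mkAlgHom ℂ (TorusRel q r u₀) (FreeAlgebra.ι ℂ (TorusGen.pos i))

/-- `e^{-S_{i+1}}` in the quantum torus. -/
def expNegS (q r u₀ : ℂ) (i : Fin 3) : QTorus q r u₀ :=
  RingQuot.mkAlgHom ℂ (TorusRel q r u₀) (FreeAlgebra.ι ℂ (TorusGen.neg i))

/-! ### The confluent Cherednik algebra -/

/-- The four generators `V₀, V₁, V̌₀, V̌₁`; the suffix `c` stands for the check accent. -/
inductive HGen : Type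
  | V0 | V1 | V0c | V1c

/-- The element `X = (V₁ + 1)(V̌₁ + u₁⁻¹ - u₁)`; note that `V̌₁ + u₁⁻¹ - u₁` is the inverse
of `V̌₁` when `(V̌₁ - u₁)(V̌₁ + u₁⁻¹) = 0`. -/
def elX {A : Type*} [Ring A] [Algebra ℂ A] (u₁ : ℂ) (V1 V1c : A) : A :=
  (V1 + 1) * (V1c + algebraMap ℂ A (u₁⁻¹ - u₁))

/-- The element `W = V̌₁ V₁`. -/
def elW {A : Type*} [Ring A] (V1 V1c : A) : A := V1c * V1

/-- The element `Y = V̌₁ V₀`. -/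
def elY {A : Type*} [Ring A] (V0 V1c : A) : A := V1c * V0

/-- The element `Z = (V₀ + 1)(V̌₁ + u₁⁻¹ - u₁)`. -/
def elZ {A : Type*} [Ring A] [Algebra ℂ A] (u₁ : ℂ) (V0 V1c : A) : A :=
  (V0 + 1) * (V1c + algebraMap ℂ A (u₁⁻¹ - u₁))

/-- The defining relations of `H_IV` for a quadruple of elements of a `ℂ`-algebra. The
parameter `r` is `q^{1/2}`. The last relation is the Lusztig-Demazure commutation relation
`Y X = q T² X Y - q T Y - T X - q^{1/2} u₀⁻¹ T` with `T = V̌₁`. -/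
structure HRelations {A : Type*} [Ring A] [Algebra ℂ A] (q r u₀ u₁ : ℂ)
    (V0 V1 V0c V1c : A) : Prop where
  quad_V0 : V0 ^ 2 + V0 = 0
  quad_V1 : V1 ^ 2 + V1 = 0
  quad_V0c : V0c ^ 2 + u₀⁻¹ • V0c = 0
  quad_V1c : (V1c - algebraMap ℂ A u₁) * (V1c + algebraMap ℂ A u₁⁻¹) = 0
  triple : r • (V1c * V1 * V0) = V0c + algebraMap ℂ A u₀⁻¹
  triple_zero : V0c * V1c * V1 = 0
  double_zero : V0 * V0c = 0
  lusztig_demazure : elY V0 V1c * elX u₁ V1 V1c =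
    q • (V1c ^ 2 * elX u₁ V1 V1c * elY V0 V1c) - q • (V1c * elY V0 V1c)
      - V1c * elX u₁ V1 V1c - (r * u₀⁻¹) • V1c

/-- The same relations, as a relation on the free algebra on `V₀, V₁, V̌₀, V̌₁`. -/
inductive HRel (q r u₀ u₁ : ℂ) : FreeAlgebra ℂ HGen → FreeAlgebra ℂ HGen → Prop
  | quad_V0 : HRel q r u₀ u₁
      ((FreeAlgebra.ι ℂ HGen.V0) ^ 2 + FreeAlgebra.ι ℂ HGen.V0) 0
  | quad_V1 : HRel q r u₀ u₁
      ((FreeAlgebra.ι ℂ HGen.V1) ^ 2 + FreeAlgebra.ι ℂ HGen.V1) 0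
  | quad_V0c : HRel q r u₀ u₁
      ((FreeAlgebra.ι ℂ HGen.V0c) ^ 2 + u₀⁻¹ • FreeAlgebra.ι ℂ HGen.V0c) 0
  | quad_V1c : HRel q r u₀ u₁
      ((FreeAlgebra.ι ℂ HGen.V1c - algebraMap ℂ (FreeAlgebra ℂ HGen) u₁) *
        (FreeAlgebra.ι ℂ HGen.V1c + algebraMap ℂ (FreeAlgebra ℂ HGen) u₁⁻¹)) 0
  | triple : HRel q r u₀ u₁
      (r • (FreeAlgebra.ι ℂ HGen.V1c * FreeAlgebra.ι ℂ HGen.V1 * FreeAlgebra.ι ℂ HGen.V0))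
      (FreeAlgebra.ι ℂ HGen.V0c + algebraMap ℂ (FreeAlgebra ℂ HGen) u₀⁻¹)
  | triple_zero : HRel q r u₀ u₁
      (FreeAlgebra.ι ℂ HGen.V0c * FreeAlgebra.ι ℂ HGen.V1c * FreeAlgebra.ι ℂ HGen.V1) 0
  | double_zero : HRel q r u₀ u₁
      (FreeAlgebra.ι ℂ HGen.V0 * FreeAlgebra.ι ℂ HGen.V0c) 0
  | lusztig_demazure : HRel q r u₀ u₁
      (elY (FreeAlgebra.ι ℂ HGen.V0) (FreeAlgebra.ι ℂ HGen.V1c) *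
        elX u₁ (FreeAlgebra.ι ℂ HGen.V1) (FreeAlgebra.ι ℂ HGen.V1c))
      (q • ((FreeAlgebra.ι ℂ HGen.V1c) ^ 2 *
          elX u₁ (FreeAlgebra.ι ℂ HGen.V1) (FreeAlgebra.ι ℂ HGen.V1c) *
          elY (FreeAlgebra.ι ℂ HGen.V0) (FreeAlgebra.ι ℂ HGen.V1c))
        - q • (FreeAlgebra.ι ℂ HGen.V1c *
          elY (FreeAlgebra.ι ℂ HGen.V0) (FreeAlgebra.ι ℂ HGen.V1c))
        - FreeAlgebra.ι ℂ HGen.V1c *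
          elX u₁ (FreeAlgebra.ι ℂ HGen.V1) (FreeAlgebra.ι ℂ HGen.V1c)
        - (r * u₀⁻¹) • FreeAlgebra.ι ℂ HGen.V1c)

/-- The confluent Cherednik algebra `H_IV`, given by generators and relations over `ℂ`. -/
abbrev HIV (q r u₀ u₁ : ℂ) : Type := RingQuot (HRel q r u₀ u₁)

/-- The class in `H_IV` of a generator. -/
def gen (q r u₀ u₁ : ℂ) (g : HGen) : HIV q r u₀ u₁ :=
  RingQuot.mkAlgHom ℂ (HRel q r u₀ u₁) (FreeAlgebra.ι ℂ g)

/-- The generators of `H_IV` satisfy the relations. -/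
theorem gen_relations (q r u₀ u₁ : ℂ) :
    HRelations q r u₀ u₁ (gen q r u₀ u₁ HGen.V0) (gen q r u₀ u₁ HGen.V1)
      (gen q r u₀ u₁ HGen.V0c) (gen q r u₀ u₁ HGen.V1c) := by
  constructor
  · simpa [gen] using RingQuot.mkAlgHom_rel ℂ (HRel.quad_V0 (q := q) (r := r) (u₀ := u₀) (u₁ := u₁))
  · simpa [gen] using RingQuot.mkAlgHom_rel ℂ (HRel.quad_V1 (q := q) (r := r) (u₀ := u₀) (u₁ := u₁))
  · simpa [gen] using RingQuot.mkAlgHom_rel ℂ (HRel.quad_V0c (q := q) (r := r) (u₀ := u₀) (u₁ := u₁))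
  · simpa only [gen, map_mul, map_sub, map_add, map_zero, AlgHom.commutes] using
      RingQuot.mkAlgHom_rel ℂ (HRel.quad_V1c (q := q) (r := r) (u₀ := u₀) (u₁ := u₁))
  · simpa only [gen, map_mul, map_smul, map_add, map_zero, AlgHom.commutes] using
      RingQuot.mkAlgHom_rel ℂ (HRel.triple (q := q) (r := r) (u₀ := u₀) (u₁ := u₁))
  · simpa only [gen, map_mul, map_zero] using
      RingQuot.mkAlgHom_rel ℂ (HRel.triple_zero (q := q) (r := r) (u₀ := u₀) (u₁ := u₁))
  · simpa only [gen, map_mul, map_zero] using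
      RingQuot.mkAlgHom_rel ℂ (HRel.double_zero (q := q) (r := r) (u₀ := u₀) (u₁ := u₁))
  · simpa only [gen, elX, elY, map_mul, map_sub, map_add, map_smul, map_pow, map_one,
      AlgHom.commutes] using
      RingQuot.mkAlgHom_rel ℂ (HRel.lusztig_demazure (q := q) (r := r) (u₀ := u₀) (u₁ := u₁))

/-- The words of which linear independence is asserted: `X^m T^ε Y^n` for `m, n ≥ 0`, where
`X^m` is replaced by `W^{-m}` if `m < 0`, and `Y^n` by `Z^{-n}` if `n < 0`; here
`T = V̌₁` and `ε ∈ {0, 1}`. -/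
def word (q r u₀ u₁ : ℂ) (m : ℤ) (ε : Fin 2) (n : ℤ) : HIV q r u₀ u₁ :=
  (if 0 ≤ m then elX u₁ (gen q r u₀ u₁ HGen.V1) (gen q r u₀ u₁ HGen.V1c) ^ m.toNat
    else elW (gen q r u₀ u₁ HGen.V1) (gen q r u₀ u₁ HGen.V1c) ^ (-m).toNat) *
  gen q r u₀ u₁ HGen.V1c ^ (ε : ℕ) *
  (if 0 ≤ n then elY (gen q r u₀ u₁ HGen.V0) (gen q r u₀ u₁ HGen.V1c) ^ n.toNat
    else elZ u₁ (gen q r u₀ u₁ HGen.V0) (gen q r u₀ u₁ HGen.V1c) ^ (-n).toNat)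

/-! ### The four matrices -/

/-- The matrix assigned to `V₀`. -/
def matV0 (q r u₀ : ℂ) : Matrix (Fin 2) (Fin 2) (QTorus q r u₀) :=
  !![-1, 0;
     1 + Complex.I • expS q r u₀ 2, 0]

/-- The matrix assigned to `V₁`. -/
def matV1 (q r u₀ : ℂ) : Matrix (Fin 2) (Fin 2) (QTorus q r u₀) :=
  !![-1 - Complex.I • expS q r u₀ 1, -1 - Complex.I • expS q r u₀ 1;
     Complex.I • expS q r u₀ 1, Complex.I • expS q r u₀ 1]

/-- The matrix assigned to `V̌₁`. -/
def matV1c (q r u₀ u₁ : ℂ) : Matrix (Fin 2) (Fin 2) (QTorus q r u₀) :=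
  !![0, -(Complex.I • expS q r u₀ 0);
     Complex.I • expNegS q r u₀ 0, algebraMap ℂ (QTorus q r u₀) (u₁ - u₁⁻¹)]

/-- The element `s = e^{-S₁} e^{S₃} + (u₁⁻¹ - u₁) e^{S₂} e^{S₃} + i e^{-S₁} e^{S₂} e^{S₃}`,
where the exponentials are multiplied in the order in which they occur in matrix products. -/
def torusS (q r u₀ u₁ : ℂ) : QTorus q r u₀ :=
  expNegS q r u₀ 0 * expS q r u₀ 2 + (u₁⁻¹ - u₁) • (expS q r u₀ 1 * expS q r u₀ 2) +
    Complex.I • (expNegS q r u₀ 0 * expS q r u₀ 1 * expS q r u₀ 2)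

/-- The matrix assigned to `V̌₀`. -/
def matV0c (q r u₀ u₁ : ℂ) : Matrix (Fin 2) (Fin 2) (QTorus q r u₀) :=
  !![0, 0;
     r • torusS q r u₀ u₁, algebraMap ℂ (QTorus q r u₀) (-u₀⁻¹)]

end

end ConfluentPIV

/-! That the matrices satisfy the relations is a normal-ordering computation in the torus
(`hRelations_of_commutation`), and the presentation then yields the homomorphism. It is injective
because the words `X^(m) T^ε Y^(n)` span `HIV` while their images are linearly independent.

Spanning (`span_word_eq_top`): the span of the words contains `1`, so it suffices that left
multiplication by each generator preserves it. Multiplication by `X` or `W` shifts `m` or gives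
zero, because `XW = WX = 0`. The quadratic relation moves `T` past `X` and `W`. The Lusztig-Demazure
relation moves `V₀` past `X`; moving it past `W` needs a cyclically rotated form of that relation,
derived in `cyclic_relation`.

Independence (`ActsOnPairs.linearIndependent_normalWord`): let the torus act on functions on `ℤ`,
with `e^{S₁}` the shift and `e^{S₃}` multiplication by `i q^j`. Then `1 + i e^{S₃}` becomes `1 -
q^j`, which vanishes at `j = 0` and, `q` not being a root of unity, nowhere else. Hence `w = (0,
δ₁)` is killed by both `Y` and `Z`, while suitable test vectors are carried by the `Y^(n)` to
nonzero multiples of `w` in a triangular pattern. This reduces the claim to independence of the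
vectors `X^(m) T^ε w`, which is read off from leading indices. -/

namespace ConfluentPIV

noncomputable section

/-! ### The four matrices satisfy the relations. -/

section MatrixRelations

variable (q r u₀ u₁ : ℂ)

theorem expS_mul_expNegS (i : Fin 3) : expS q r u₀ i * expNegS q r u₀ i = 1 := by
  simpa [expS, expNegS] using RingQuot.mkAlgHom_rel ℂ (TorusRel.pos_neg (q := q) (r := r) (u₀ := u₀) i)

theorem expNegS_mul_expS (i : Fin 3) : expNegS q r u₀ i * expS q r u₀ i = 1 := by
  simpa [expS, expNegS] using RingQuot.mkAlgHom_rel ℂ (TorusRel.neg_pos (q := q) (r := r) (u₀ := u₀) i)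

theorem expS_mul_expS_succ (i : Fin 3) :
    expS q r u₀ i * expS q r u₀ (i + 1) = q⁻¹ • (expS q r u₀ (i + 1) * expS q r u₀ i) := by
  simpa only [expS, map_mul, map_smul] using
    RingQuot.mkAlgHom_rel ℂ (TorusRel.comm (q := q) (r := r) (u₀ := u₀) i)

theorem expS_total :
    expS q r u₀ 0 * expS q r u₀ 1 * expS q r u₀ 2 =
      algebraMap ℂ (QTorus q r u₀) (-Complex.I / (r * u₀)) := by
  simpa only [expS, map_mul, AlgHom.commutes] using
    RingQuot.mkAlgHom_rel ℂ (TorusRel.total (q := q) (r := r) (u₀ := u₀))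

variable {q r u₀}

theorem expS_one_mul_two :
    expS q r u₀ 1 * expS q r u₀ 2 = (-Complex.I / (r * u₀)) • expNegS q r u₀ 0 := by
  have h := congrArg (expNegS q r u₀ 0 * ·) (expS_total q r u₀)
  simpa only [mul_assoc, ← mul_assoc (expNegS q r u₀ 0), expNegS_mul_expS, one_mul,
    ← Algebra.commutes, ← Algebra.smul_def] using h

theorem expS_two_mul_one (hq : q ≠ 0) :
    expS q r u₀ 2 * expS q r u₀ 1 = (q * (-Complex.I / (r * u₀))) • expNegS q r u₀ 0 := by
  have h := expS_mul_expS_succ q r u₀ 1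
  rw [show (1 : Fin 3) + 1 = 2 from rfl, expS_one_mul_two] at h
  rw [mul_smul, h, smul_smul, mul_inv_cancel₀ hq, one_smul]

theorem expS_one_mul_zero (hq : q ≠ 0) :
    expS q r u₀ 1 * expS q r u₀ 0 = q • (expS q r u₀ 0 * expS q r u₀ 1) := by
  have h := expS_mul_expS_succ q r u₀ 0
  rw [show (0 : Fin 3) + 1 = 1 from rfl] at h
  rw [h, smul_smul, mul_inv_cancel₀ hq, one_smul]

theorem expS_two_mul_zero :
    expS q r u₀ 2 * expS q r u₀ 0 = q⁻¹ • (expS q r u₀ 0 * expS q r u₀ 2) :=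
  expS_mul_expS_succ q r u₀ 2

theorem mul_expNegS_zero_of_comm {a : ℂ} (ha : a ≠ 0) {x : QTorus q r u₀}
    (h : x * expS q r u₀ 0 = a • (expS q r u₀ 0 * x)) :
    x * expNegS q r u₀ 0 = a⁻¹ • (expNegS q r u₀ 0 * x) := by
  have h2 := congrArg (fun y => a⁻¹ • (expNegS q r u₀ 0 * y * expNegS q r u₀ 0)) h
  simp only [mul_smul_comm, smul_mul_assoc, smul_smul, inv_mul_cancel₀ ha, one_smul] at h2
  rw [← mul_assoc (expNegS q r u₀ 0) (expS q r u₀ 0), expNegS_mul_expS, one_mul, mul_assoc,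
    mul_assoc, expS_mul_expNegS, mul_one] at h2
  exact h2.symm

theorem expS_one_mul_neg_zero (hq : q ≠ 0) :
    expS q r u₀ 1 * expNegS q r u₀ 0 = q⁻¹ • (expNegS q r u₀ 0 * expS q r u₀ 1) :=
  mul_expNegS_zero_of_comm hq (expS_one_mul_zero hq)

theorem expS_two_mul_neg_zero (hq : q ≠ 0) :
    expS q r u₀ 2 * expNegS q r u₀ 0 = q • (expNegS q r u₀ 0 * expS q r u₀ 2) := by
  simpa using mul_expNegS_zero_of_comm (inv_ne_zero hq) (expS_two_mul_zero (r := r) (u₀ := u₀))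

theorem mul_mul_of_mul_eq_smul {R : Type*} [Ring R] [Algebra ℂ R] {x y z : R} {a : ℂ}
    (h : x * y = a • z) (w : R) : x * (y * w) = a • (z * w) := by
  rw [← mul_assoc, h, smul_mul_assoc]

theorem mul_mul_of_mul_eq_one {R : Type*} [Ring R] {x y : R} (h : x * y = 1) (w : R) :
    x * (y * w) = w := by
  rw [← mul_assoc, h, one_mul]

theorem mul_fin_two_elems {R : Type*} [Ring R] (a b c d a' b' c' d' : R) :
    (!![a, b; c, d] * !![a', b'; c', d'] : Matrix (Fin 2) (Fin 2) R) =
      !![a * a' + b * c', a * b' + b * d'; c * a' + d * c', c * b' + d * d'] :=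
  Matrix.mul_fin_two _ _ _ _ _ _ _ _

/-- With `A, A', B, C` standing for `e^{S₁}, e^{-S₁}, e^{S₂}, e^{S₃}`, the hypotheses act as
rewriting rules: `A` and `A'` move to the left, and `B * C`, `C * B` collapse to multiples of `A'`.
Each matrix entry then becomes an identity between coefficients of normally ordered monomials.
Writing `q` as `r ^ 2` makes these coefficients rational in `r`, `u₀`, `u₁` over the powers of `i`.
-/
theorem hRelations_of_commutation {R : Type*} [Ring R] [Algebra ℂ R] {A A' B C : R}
    (hr : r ≠ 0) (hu₀ : u₀ ≠ 0) (hu₁ : u₁ ≠ 0)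
    (e1 : A * A' = 1) (e2 : A' * A = 1)
    (e3 : B * C = (-Complex.I / (r * u₀)) • A')
    (e4 : C * B = (r ^ 2 * (-Complex.I / (r * u₀))) • A')
    (e5 : B * A = r ^ 2 • (A * B)) (e6 : C * A = (r ^ 2)⁻¹ • (A * C))
    (e7 : B * A' = (r ^ 2)⁻¹ • (A' * B)) (e8 : C * A' = r ^ 2 • (A' * C)) :
    HRelations (r ^ 2) r u₀ u₁
      !![-1, 0; 1 + Complex.I • C, 0]
      !![-1 - Complex.I • B, -1 - Complex.I • B; Complex.I • B, Complex.I • B]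
      !![0, 0; r • (A' * C + (u₁⁻¹ - u₁) • (B * C) + Complex.I • (A' * B * C)),
        algebraMap ℂ R (-u₀⁻¹)]
      !![0, -(Complex.I • A); Complex.I • A', algebraMap ℂ R (u₁ - u₁⁻¹)] := by
  have f1 := mul_mul_of_mul_eq_one e1
  have f2 := mul_mul_of_mul_eq_one e2
  have f5 := mul_mul_of_mul_eq_smul e5
  have f6 := mul_mul_of_mul_eq_smul e6
  have f8 := mul_mul_of_mul_eq_smul e8
  have hI : Complex.I ^ 2 = -1 := Complex.I_sq
  have hI3 : Complex.I ^ 3 = -Complex.I := Complex.I_pow_three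
  have hI4 : Complex.I ^ 4 = 1 := Complex.I_pow_four
  have hI6 : Complex.I ^ 6 = -1 := by rw [show 6 = 4 + 2 from rfl, pow_add, hI4, hI, one_mul]
  constructor
  all_goals
    simp only [elX, elY, pow_two, mul_fin_two_elems, Matrix.smul_of,
      Matrix.smul_cons, Matrix.smul_empty, Matrix.one_fin_two, Matrix.of_add_of, Matrix.of_sub_of,
      Matrix.add_cons, Matrix.sub_cons, Matrix.head_cons, Matrix.tail_cons, Matrix.empty_add_empty,
      Matrix.empty_sub_empty, Algebra.algebraMap_eq_smul_one]
    ext i j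
    fin_cases i <;> fin_cases j
  all_goals
    simp only [Matrix.of_apply, Matrix.cons_val', Matrix.cons_val_zero, Matrix.cons_val_one,
      Matrix.cons_val_fin_one, Fin.zero_eta, Fin.mk_one, Fin.isValue, Matrix.zero_apply]
    simp only [mul_assoc, add_mul, mul_add, sub_mul, mul_sub, neg_mul, mul_neg,
      smul_mul_assoc, mul_smul_comm, mul_one, one_mul, mul_zero, zero_mul, smul_add, smul_sub,
      smul_neg, smul_zero, neg_neg, neg_zero, add_zero, zero_add, sub_zero,
      e1, e2, e3, e4, e5, e6, e7, e8, f1, f2, f5, f6, f8]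
    try first
    | exact add_neg_cancel _
    | match_scalars <;> field_simp <;> ring_nf <;> simp only [hI, hI3, hI4, hI6] <;> ring_nf

theorem mat_relations (hr : r ^ 2 = q) (hq : q ≠ 0) (hu₀ : u₀ ≠ 0) (hu₁ : u₁ ≠ 0) :
    HRelations q r u₀ u₁ (matV0 q r u₀) (matV1 q r u₀) (matV0c q r u₀ u₁)
      (matV1c q r u₀ u₁) := by
  subst hr
  exact hRelations_of_commutation u₁ (fun h => hq (by simp [h])) hu₀ hu₁
    (expS_mul_expNegS _ _ _ 0) (expNegS_mul_expS _ _ _ 0) expS_one_mul_two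
    (expS_two_mul_one hq) (expS_one_mul_zero hq) expS_two_mul_zero (expS_one_mul_neg_zero hq)
    (expS_two_mul_neg_zero hq)

end MatrixRelations

/-! ### Consequences of the relations in an arbitrary algebra. -/

section AbstractRelations

variable {R : Type*} [Ring R] [Algebra ℂ R] {q r u₀ u₁ : ℂ} {V0 V1 V0c T : R}

/-- The inverse of `V̌₁`. -/
def invV1c (u₁ : ℂ) (T : R) : R := T + algebraMap ℂ R (u₁⁻¹ - u₁)

theorem invV1c_eq (u₁ : ℂ) (T : R) : invV1c u₁ T = T - (u₁ - u₁⁻¹) • 1 := by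
  rw [invV1c, Algebra.algebraMap_eq_smul_one]
  module

/-- If `e`, `f` are idempotents and `T` is invertible, the relation
`e f T⁻¹ = q T (1 - f) (1 - e) - k` implies its cyclic rotation. -/
theorem cyclic_relation {e f T t : R} {q k : ℂ} (htT : t * T = 1)
    (hee : e * e = e) (hff : f * f = f)
    (h : e * (f * t) = q • (T * ((f - 1) * (e - 1))) - k • 1) (hk : k ≠ 0) :
    f * (t * e) = q • ((e - 1) * (T * (f - 1))) - k • 1 := by
  have htT' : ∀ x, t * (T * x) = x := fun x => by rw [← mul_assoc, htT, one_mul]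
  obtain ⟨g, hg⟩ : ∃ g, g = (f - 1) * (e - 1) := ⟨_, rfl⟩
  rw [← hg] at h
  have hfg : f * g = 0 := by
    rw [hg, ← mul_assoc, mul_sub f f 1, hff, mul_one, sub_self, zero_mul]
  have hfg' : ∀ x, f * (g * x) = 0 := fun x => by rw [← mul_assoc, hfg, zero_mul]
  have hef : e * f = q • (T * (g * T)) - k • T := by
    have := congrArg (· * T) h
    simpa only [mul_assoc, htT, mul_one, sub_mul, smul_mul_assoc, one_mul] using this
  -- Here `f * g = 0` kills the term in `g`, so `f t e f` is a scalar multiple of `f`.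
  have hftef : f * (t * (e * f)) = -(k • f) := by
    rw [hef]
    simp only [mul_sub, mul_smul_comm, htT', htT, hfg', smul_zero, mul_one, zero_sub]
  have hftef' : ∀ x, f * (t * (e * (f * x))) = -(k • (f * x)) := fun x => by
    simpa only [mul_assoc, neg_mul, smul_mul_assoc] using congrArg (· * x) hftef
  -- Multiplying the formula for `e * f` by `f - 1` on the right gives zero, since `f` is
  -- idempotent; `t` then cancels the leading `T`.
  have hgTf : q • (g * (T * (f - 1))) = k • (f - 1) := by
    have h2 : (e * f) * (f - 1) = 0 := by rw [mul_assoc, mul_sub, hff, mul_one, sub_self, mul_zero]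
    rw [hef] at h2
    have h3 := congrArg (t * ·) h2
    simp only [sub_mul, smul_mul_assoc, mul_assoc, mul_sub t, mul_smul_comm, htT', mul_zero] at h3
    exact sub_eq_zero.1 h3
  have heg : e * g = e * (f * e) - e * f := by
    rw [hg, sub_mul, mul_sub f, mul_one, one_mul, mul_sub, mul_sub, mul_sub, mul_one, hee]
    abel
  have hqg : q • g = t * (e * (f * t)) + k • t := by
    rw [h, mul_sub, mul_smul_comm, htT', mul_smul_comm, mul_one, sub_add_cancel]
  -- The word `f t e t e f` is evaluated twice: here through its final `e * f`, and in `s3` through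
  -- `q g = t e f t + k t`. Comparing the results and cancelling `k` gives `s6`, which is the claim
  -- multiplied by `f` in part; `hgTf` removes this extra `f`.
  have s1 : f * (t * (e * (t * (e * f)))) =
      -((q * k) • (f * (e * T))) + (q * k) • (f * T) - k • (f * (t * e)) := by
    have s2 : f * (t * (e * (g * T))) = -(k • (f * (e * T))) + k • (f * T) := by
      rw [← mul_assoc e g, heg]
      simp only [sub_mul, mul_sub, mul_assoc, hftef']
      abel
    rw [hef]
    simp only [mul_sub, mul_smul_comm, htT', htT, mul_one, s2]
    module
  have s3 : q • (f * (t * (e * (g * (T * f))))) = f * (t * (e * (t * (e * f)))) - (k * k) • f := by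
    have s4 : f * (t * (e * ((q • g) * (T * f)))) =
        f * (t * (e * (t * (e * f)))) - (k * k) • f := by
      rw [hqg]
      simp only [add_mul, mul_assoc, smul_mul_assoc, mul_add, mul_smul_comm, htT', hff, hftef]
      module
    simpa only [smul_mul_assoc, mul_smul_comm] using s4
  have s5 : f * (t * (e * (g * (T * f)))) = -(k • (f * (e * (T * f)))) + k • (f * (T * f)) := by
    rw [← mul_assoc e g, heg]
    simp only [sub_mul, mul_sub, mul_assoc, hftef']
    abel
  rw [s5, s1] at s3
  have s6 : f * (t * e) = q • (f * ((e - 1) * (T * (f - 1)))) - k • f := by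
    apply smul_right_injective R hk
    simp only [sub_mul, mul_sub, mul_one, one_mul]
    linear_combination (norm := module) s3
  have s7 : f * ((e - 1) * (T * (f - 1))) = g * (T * (f - 1)) + (e - 1) * (T * (f - 1)) := by
    rw [hg]; noncomm_ring
  rw [s6, s7, smul_add, hgTf]
  module

namespace HRelations

theorem sq_V1c (h : HRelations q r u₀ u₁ V0 V1 V0c T) (hu₁ : u₁ ≠ 0) :
    T * T = (u₁ - u₁⁻¹) • T + 1 := by
  have h1 := h.quad_V1c
  simp only [Algebra.algebraMap_eq_smul_one, sub_mul, mul_add, smul_mul_assoc, mul_smul_comm,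
    mul_one, one_mul] at h1
  rw [← sub_eq_zero, ← h1]
  match_scalars <;> field_simp
  ring

theorem V1c_mul_inv (h : HRelations q r u₀ u₁ V0 V1 V0c T) (hu₁ : u₁ ≠ 0) :
    T * invV1c u₁ T = 1 := by
  rw [invV1c_eq, mul_sub, h.sq_V1c hu₁, mul_smul_comm, mul_one]
  abel

theorem inv_mul_V1c (h : HRelations q r u₀ u₁ V0 V1 V0c T) (hu₁ : u₁ ≠ 0) :
    invV1c u₁ T * T = 1 := by
  rw [invV1c_eq, sub_mul, h.sq_V1c hu₁, smul_mul_assoc, one_mul]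
  abel

theorem V0_mul_V0 (h : HRelations q r u₀ u₁ V0 V1 V0c T) : V0 * V0 = -V0 := by
  rw [← pow_two]; exact eq_neg_of_add_eq_zero_left h.quad_V0

theorem V1_mul_V1 (h : HRelations q r u₀ u₁ V0 V1 V0c T) : V1 * V1 = -V1 := by
  rw [← pow_two]; exact eq_neg_of_add_eq_zero_left h.quad_V1

/-- The Lusztig-Demazure relation multiplied on the left by `V̌₁⁻¹`. -/
theorem one_add_V0_mul_one_add_V1 (h : HRelations q r u₀ u₁ V0 V1 V0c T) (hu₁ : u₁ ≠ 0) :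
    (V0 + 1) * ((V1 + 1) * invV1c u₁ T) = q • (T * (V1 * V0)) - (r * u₀⁻¹) • 1 := by
  have h1 := congrArg (invV1c u₁ T * ·) h.lusztig_demazure
  have ht : ∀ x, invV1c u₁ T * (T * x) = x := fun x => by
    rw [← mul_assoc, h.inv_mul_V1c hu₁, one_mul]
  have e1 : elX u₁ V1 T = (V1 + 1) * invV1c u₁ T := rfl
  simp only [e1, elY, pow_two, mul_sub, mul_smul_comm, mul_assoc, ht, h.inv_mul_V1c hu₁] at h1
  rw [add_mul, one_mul, h1, add_mul V1 1 V0, one_mul, mul_add]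
  module

/-- This form contains `V₀ T V₁ = V₀ W`, and so lets `V₀` pass `W`. The rotation applies because `V₀
+ 1` and `V₁ + 1` are idempotent. -/
theorem one_add_V1_mul_one_add_V0 (h : HRelations q r u₀ u₁ V0 V1 V0c T) (hu₁ : u₁ ≠ 0)
    (hk : r * u₀⁻¹ ≠ 0) :
    (V1 + 1) * (invV1c u₁ T * (V0 + 1)) = q • (V0 * (T * V1)) - (r * u₀⁻¹) • 1 := by
  have h1 := h.one_add_V0_mul_one_add_V1 hu₁
  have htT := h.inv_mul_V1c hu₁
  have hee : (V0 + 1) * (V0 + 1) = V0 + 1 := by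
    rw [add_mul, mul_add, h.V0_mul_V0]; noncomm_ring
  have hff : (V1 + 1) * (V1 + 1) = V1 + 1 := by
    rw [add_mul, mul_add, h.V1_mul_V1]; noncomm_ring
  have hV0 : V0 = (V0 + 1) - 1 := by abel
  have hV1 : V1 = (V1 + 1) - 1 := by abel
  generalize r * u₀⁻¹ = k at *
  generalize invV1c u₁ T = t at *
  generalize V0 + 1 = e at *
  generalize V1 + 1 = f at *
  clear h
  subst hV0 hV1
  exact cyclic_relation htT hee hff h1 hk

end HRelations

end AbstractRelations

/-! ### Powers indexed by the integers. -/

section TwoSidedPower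

variable {R : Type*} [Ring R]

/-- `x ^ m` for `m ≥ 0` and `w ^ (-m)` for `m < 0`. -/
def twoSidedPow (x w : R) (m : ℤ) : R := if 0 ≤ m then x ^ m.toNat else w ^ (-m).toNat

theorem twoSidedPow_natCast (x w : R) (k : ℕ) : twoSidedPow x w k = x ^ k := by
  simp [twoSidedPow]

theorem twoSidedPow_neg_natCast (x w : R) (k : ℕ) : twoSidedPow x w (-k) = w ^ k := by
  rcases Nat.eq_zero_or_pos k with rfl | hk
  · simp [twoSidedPow]
  · rw [twoSidedPow, if_neg (by omega), neg_neg, Int.toNat_natCast]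

theorem mul_twoSidedPow_left {x w : R} (h : x * w = 0) (m : ℤ) :
    x * twoSidedPow x w m = if 0 ≤ m then twoSidedPow x w (m + 1) else 0 := by
  split_ifs with hm
  · lift m to ℕ using hm
    rw [twoSidedPow_natCast, ← Nat.cast_succ, twoSidedPow_natCast, pow_succ']
  · obtain ⟨k, rfl⟩ : ∃ k : ℕ, m = -((k + 1 : ℕ) : ℤ) := ⟨(-m).toNat - 1, by omega⟩
    rw [twoSidedPow_neg_natCast, pow_succ', ← mul_assoc, h, zero_mul]

theorem mul_twoSidedPow_right {x w : R} (h : w * x = 0) (m : ℤ) :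
    w * twoSidedPow x w m = if m ≤ 0 then twoSidedPow x w (m - 1) else 0 := by
  split_ifs with hm
  · obtain ⟨k, rfl⟩ : ∃ k : ℕ, m = -(k : ℤ) := ⟨(-m).toNat, by omega⟩
    rw [twoSidedPow_neg_natCast, show (-(k : ℤ) - 1) = -((k + 1 : ℕ) : ℤ) by push_cast; ring,
      twoSidedPow_neg_natCast, pow_succ']
  · obtain ⟨k, rfl⟩ : ∃ k : ℕ, m = ((k + 1 : ℕ) : ℤ) := ⟨m.toNat - 1, by omega⟩
    rw [twoSidedPow_natCast, pow_succ', ← mul_assoc, h, zero_mul]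

end TwoSidedPower

/-! ### The words span the algebra. -/

section Words

variable {R : Type*} [Ring R] [Algebra ℂ R] {q r u₀ u₁ : ℂ} {V0 V1 V0c T : R}

/-- The words `X^(m) T^ε Y^(n)` in elements `V₀`, `V₁`, `T` of an algebra. -/
def normalWord (u₁ : ℂ) (V0 V1 T : R) (m : ℤ) (ε : Fin 2) (n : ℤ) : R :=
  twoSidedPow (elX u₁ V1 T) (elW V1 T) m * T ^ (ε : ℕ) *
    twoSidedPow (elY V0 T) (elZ u₁ V0 T) n

theorem map_word {A : Type*} [Ring A] [Algebra ℂ A] (F : HIV q r u₀ u₁ →ₐ[ℂ] A)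
    (m : ℤ) (ε : Fin 2) (n : ℤ) :
    F (word q r u₀ u₁ m ε n) =
      normalWord u₁ (F (gen q r u₀ u₁ HGen.V0)) (F (gen q r u₀ u₁ HGen.V1))
        (F (gen q r u₀ u₁ HGen.V1c)) m ε n := by
  unfold word normalWord twoSidedPow
  split_ifs <;> simp [elX, elY, elZ, elW]

/-- The span of the words. -/
def wordSpan (u₁ : ℂ) (V0 V1 T : R) : Submodule ℂ R :=
  Submodule.span ℂ (Set.range fun w : ℤ × Fin 2 × ℤ => normalWord u₁ V0 V1 T w.1 w.2.1 w.2.2)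

theorem normalWord_mem (u₁ : ℂ) (V0 V1 T : R) (m : ℤ) (ε : Fin 2) (n : ℤ) :
    normalWord u₁ V0 V1 T m ε n ∈ wordSpan u₁ V0 V1 T :=
  Submodule.subset_span ⟨(m, ε, n), rfl⟩

theorem mul_mem_wordSpan {a : R}
    (h : ∀ m ε n, a * normalWord u₁ V0 V1 T m ε n ∈ wordSpan u₁ V0 V1 T) {x : R}
    (hx : x ∈ wordSpan u₁ V0 V1 T) : a * x ∈ wordSpan u₁ V0 V1 T := by
  induction hx using Submodule.span_induction with
  | mem x hx => obtain ⟨w, rfl⟩ := hx; exact h _ _ _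
  | zero => rw [mul_zero]; exact zero_mem _
  | add x y _ _ hx hy => rw [mul_add]; exact add_mem hx hy
  | smul c x _ hx => rw [mul_smul_comm]; exact Submodule.smul_mem _ _ hx

theorem normalWord_natSucc (u₁ : ℂ) (V0 V1 T : R) (k : ℕ) (ε : Fin 2) (n : ℤ) :
    normalWord u₁ V0 V1 T ((k + 1 : ℕ) : ℤ) ε n = elX u₁ V1 T * normalWord u₁ V0 V1 T k ε n := by
  simp only [normalWord, twoSidedPow_natCast, pow_succ' _ k, mul_assoc]

theorem normalWord_neg_natSucc (u₁ : ℂ) (V0 V1 T : R) (k : ℕ) (ε : Fin 2) (n : ℤ) :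
    normalWord u₁ V0 V1 T (-((k + 1 : ℕ) : ℤ)) ε n =
      elW V1 T * normalWord u₁ V0 V1 T (-(k : ℤ)) ε n := by
  simp only [normalWord, twoSidedPow_neg_natCast, pow_succ' _ k, mul_assoc]

theorem normalWord_zero_zero (u₁ : ℂ) (V0 V1 T : R) (n : ℤ) :
    normalWord u₁ V0 V1 T 0 0 n = twoSidedPow (elY V0 T) (elZ u₁ V0 T) n := by
  simp [normalWord, twoSidedPow]

theorem normalWord_zero_one (u₁ : ℂ) (V0 V1 T : R) (n : ℤ) :
    normalWord u₁ V0 V1 T 0 1 n = T * twoSidedPow (elY V0 T) (elZ u₁ V0 T) n := by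
  simp [normalWord, twoSidedPow]

/-- Induction on `|m|` for a property of the words. -/
theorem normalWord_induction {p : R → Prop}
    (h0 : ∀ n, p (twoSidedPow (elY V0 T) (elZ u₁ V0 T) n))
    (h1 : ∀ n, p (T * twoSidedPow (elY V0 T) (elZ u₁ V0 T) n))
    (hX : ∀ m ε n, p (normalWord u₁ V0 V1 T m ε n) →
      p (elX u₁ V1 T * normalWord u₁ V0 V1 T m ε n))
    (hW : ∀ m ε n, p (normalWord u₁ V0 V1 T m ε n) →
      p (elW V1 T * normalWord u₁ V0 V1 T m ε n)) (m : ℤ) (ε : Fin 2) (n : ℤ) :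
    p (normalWord u₁ V0 V1 T m ε n) := by
  have hbase : p (normalWord u₁ V0 V1 T 0 ε n) := by
    fin_cases ε
    · change p (normalWord u₁ V0 V1 T 0 0 n)
      rw [normalWord_zero_zero]; exact h0 n
    · change p (normalWord u₁ V0 V1 T 0 1 n)
      rw [normalWord_zero_one]; exact h1 n
  obtain ⟨k, rfl | rfl⟩ := m.eq_nat_or_neg
  · induction k with
    | zero => exact hbase
    | succ k ih => rw [normalWord_natSucc]; exact hX _ _ _ ih
  · induction k with
    | zero => simpa using hbase
    | succ k ih => rw [normalWord_neg_natSucc]; exact hW _ _ _ ih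

namespace HRelations

theorem V1_mul_one_add (h : HRelations q r u₀ u₁ V0 V1 V0c T) : V1 * (V1 + 1) = 0 := by
  rw [mul_add, h.V1_mul_V1, mul_one, neg_add_cancel]

theorem one_add_mul_V1 (h : HRelations q r u₀ u₁ V0 V1 V0c T) : (V1 + 1) * V1 = 0 := by
  rw [add_mul, h.V1_mul_V1, one_mul, neg_add_cancel]

theorem V0_mul_one_add (h : HRelations q r u₀ u₁ V0 V1 V0c T) : V0 * (V0 + 1) = 0 := by
  rw [mul_add, h.V0_mul_V0, mul_one, neg_add_cancel]

theorem one_add_mul_V0 (h : HRelations q r u₀ u₁ V0 V1 V0c T) : (V0 + 1) * V0 = 0 := by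
  rw [add_mul, h.V0_mul_V0, one_mul, neg_add_cancel]

theorem elX_mul_elW (h : HRelations q r u₀ u₁ V0 V1 V0c T) (hu₁ : u₁ ≠ 0) :
    elX u₁ V1 T * elW V1 T = 0 := by
  change (V1 + 1) * invV1c u₁ T * (T * V1) = 0
  rw [mul_assoc, ← mul_assoc _ T, h.inv_mul_V1c hu₁, one_mul, h.one_add_mul_V1]

theorem elW_mul_elX (h : HRelations q r u₀ u₁ V0 V1 V0c T) : elW V1 T * elX u₁ V1 T = 0 := by
  change T * V1 * ((V1 + 1) * invV1c u₁ T) = 0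
  rw [mul_assoc, ← mul_assoc V1, h.V1_mul_one_add, zero_mul, mul_zero]

theorem elZ_mul_elY (h : HRelations q r u₀ u₁ V0 V1 V0c T) (hu₁ : u₁ ≠ 0) :
    elZ u₁ V0 T * elY V0 T = 0 := by
  change (V0 + 1) * invV1c u₁ T * (T * V0) = 0
  rw [mul_assoc, ← mul_assoc _ T, h.inv_mul_V1c hu₁, one_mul, h.one_add_mul_V0]

theorem elY_mul_elZ (h : HRelations q r u₀ u₁ V0 V1 V0c T) : elY V0 T * elZ u₁ V0 T = 0 := by
  change T * V0 * ((V0 + 1) * invV1c u₁ T) = 0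
  rw [mul_assoc, ← mul_assoc V0, h.V0_mul_one_add, zero_mul, mul_zero]

theorem elX_mul_V1c (h : HRelations q r u₀ u₁ V0 V1 V0c T) (hu₁ : u₁ ≠ 0) :
    elX u₁ V1 T * T = V1 + 1 := by
  change (V1 + 1) * invV1c u₁ T * T = V1 + 1
  rw [mul_assoc, h.inv_mul_V1c hu₁, mul_one]

theorem elZ_mul_V1c (h : HRelations q r u₀ u₁ V0 V1 V0c T) (hu₁ : u₁ ≠ 0) :
    elZ u₁ V0 T * T = V0 + 1 := by
  change (V0 + 1) * invV1c u₁ T * T = V0 + 1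
  rw [mul_assoc, h.inv_mul_V1c hu₁, mul_one]

/-- Conjugating `V₁ + 1` by `T` gives `1 + W T⁻¹`. With `V1c_mul_elW`, it moves `T` to the right
past `X` and `W`, exchanging the two, so that stability of the span under `T` follows by induction
on `|m|`. -/
theorem V1c_mul_elX (h : HRelations q r u₀ u₁ V0 V1 V0c T) (hu₁ : u₁ ≠ 0) :
    T * elX u₁ V1 T = 1 + elW V1 T * T - (u₁ - u₁⁻¹) • elW V1 T := by
  change T * ((V1 + 1) * invV1c u₁ T) = 1 + T * V1 * T - (u₁ - u₁⁻¹) • (T * V1)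
  rw [add_mul, mul_add, one_mul, h.V1c_mul_inv hu₁, invV1c_eq, mul_sub, mul_sub, mul_smul_comm,
    mul_smul_comm, mul_one, mul_assoc]
  abel

theorem V1c_mul_elW (h : HRelations q r u₀ u₁ V0 V1 V0c T) (hu₁ : u₁ ≠ 0) :
    T * elW V1 T = (u₁ - u₁⁻¹) • elW V1 T + elX u₁ V1 T * T - 1 := by
  rw [h.elX_mul_V1c hu₁, elW, ← mul_assoc, h.sq_V1c hu₁, add_mul, smul_mul_assoc, one_mul]
  abel

/-- This is `V₀ = T⁻¹ Y` with `T⁻¹` expanded; it turns `V₀ Y^(n)` into words. -/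
theorem V0_eq (h : HRelations q r u₀ u₁ V0 V1 V0c T) (hu₁ : u₁ ≠ 0) :
    V0 = T * elY V0 T - (u₁ - u₁⁻¹) • elY V0 T := by
  rw [elY, ← mul_assoc, h.sq_V1c hu₁, add_mul, smul_mul_assoc, one_mul]
  abel

theorem V0_mul_V1c (h : HRelations q r u₀ u₁ V0 V1 V0c T) (hu₁ : u₁ ≠ 0) :
    V0 * T = (u₁ - u₁⁻¹) • (V0 + 1) + elZ u₁ V0 T - T := by
  have h1 : (V0 + 1) * T = (u₁ - u₁⁻¹) • (V0 + 1) + elZ u₁ V0 T := by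
    rw [← h.elZ_mul_V1c hu₁, mul_assoc, h.sq_V1c hu₁, mul_add, mul_smul_comm, mul_one]
  rw [← h1, add_mul, one_mul, add_sub_cancel_right]

theorem V0_mul_elX (h : HRelations q r u₀ u₁ V0 V1 V0c T) (hu₁ : u₁ ≠ 0) :
    V0 * elX u₁ V1 T = q • (T * (V1 * V0)) - (r * u₀⁻¹) • 1 - elX u₁ V1 T := by
  rw [← h.one_add_V0_mul_one_add_V1 hu₁, add_mul, one_mul]
  exact (add_sub_cancel_right _ _).symm

theorem V0_mul_elW (h : HRelations q r u₀ u₁ V0 V1 V0c T) (hu₁ : u₁ ≠ 0) (hq : q ≠ 0)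
    (hk : r * u₀⁻¹ ≠ 0) :
    V0 * elW V1 T = q⁻¹ • ((V1 + 1) * (invV1c u₁ T * (V0 + 1)) + (r * u₀⁻¹) • 1) := by
  rw [h.one_add_V1_mul_one_add_V0 hu₁ hk, sub_add_cancel, smul_smul, inv_mul_cancel₀ hq,
    one_smul, elW]

theorem elX_mul_mem (h : HRelations q r u₀ u₁ V0 V1 V0c T) (hu₁ : u₁ ≠ 0) {x : R}
    (hx : x ∈ wordSpan u₁ V0 V1 T) : elX u₁ V1 T * x ∈ wordSpan u₁ V0 V1 T := by
  refine mul_mem_wordSpan (fun m ε n => ?_) hx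
  rw [normalWord, ← mul_assoc, ← mul_assoc, mul_twoSidedPow_left (h.elX_mul_elW hu₁)]
  split_ifs
  · exact normalWord_mem _ _ _ _ _ _ _
  · simp

theorem elW_mul_mem (h : HRelations q r u₀ u₁ V0 V1 V0c T) {x : R}
    (hx : x ∈ wordSpan u₁ V0 V1 T) : elW V1 T * x ∈ wordSpan u₁ V0 V1 T := by
  refine mul_mem_wordSpan (fun m ε n => ?_) hx
  rw [normalWord, ← mul_assoc, ← mul_assoc, mul_twoSidedPow_right h.elW_mul_elX]
  split_ifs
  · exact normalWord_mem _ _ _ _ _ _ _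
  · simp

theorem twoSidedPow_mem (n : ℤ) :
    twoSidedPow (elY V0 T) (elZ u₁ V0 T) n ∈ wordSpan u₁ V0 V1 T := by
  rw [← normalWord_zero_zero]; exact normalWord_mem _ _ _ _ _ _ _

theorem V1c_mul_mem (h : HRelations q r u₀ u₁ V0 V1 V0c T) (hu₁ : u₁ ≠ 0) {x : R}
    (hx : x ∈ wordSpan u₁ V0 V1 T) : T * x ∈ wordSpan u₁ V0 V1 T := by
  refine mul_mem_wordSpan (normalWord_induction (p := fun y => T * y ∈ wordSpan u₁ V0 V1 T)
    ?_ ?_ ?_ ?_) hx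
  · intro n
    rw [← normalWord_zero_one]; exact normalWord_mem _ _ _ _ _ _ _
  · intro n
    rw [← mul_assoc, h.sq_V1c hu₁, add_mul, smul_mul_assoc, one_mul, ← normalWord_zero_one]
    exact add_mem (Submodule.smul_mem _ _ (normalWord_mem _ _ _ _ _ _ _)) (twoSidedPow_mem n)
  · intro m ε n ih
    rw [← mul_assoc, h.V1c_mul_elX hu₁, sub_mul, add_mul, one_mul, smul_mul_assoc, mul_assoc]
    exact sub_mem (add_mem (normalWord_mem _ _ _ _ _ _ _) (h.elW_mul_mem ih))
      (Submodule.smul_mem _ _ (h.elW_mul_mem (normalWord_mem _ _ _ _ _ _ _)))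
  · intro m ε n ih
    rw [← mul_assoc, h.V1c_mul_elW hu₁, sub_mul, add_mul, one_mul, smul_mul_assoc, mul_assoc]
    exact sub_mem (add_mem (Submodule.smul_mem _ _ (h.elW_mul_mem (normalWord_mem _ _ _ _ _ _ _)))
      (h.elX_mul_mem hu₁ ih)) (normalWord_mem _ _ _ _ _ _ _)

theorem one_add_V1_mul_mem (h : HRelations q r u₀ u₁ V0 V1 V0c T) (hu₁ : u₁ ≠ 0) {x : R}
    (hx : x ∈ wordSpan u₁ V0 V1 T) : (V1 + 1) * x ∈ wordSpan u₁ V0 V1 T := by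
  rw [← h.elX_mul_V1c hu₁, mul_assoc]
  exact h.elX_mul_mem hu₁ (h.V1c_mul_mem hu₁ hx)

theorem V1_mul_mem (h : HRelations q r u₀ u₁ V0 V1 V0c T) (hu₁ : u₁ ≠ 0) {x : R}
    (hx : x ∈ wordSpan u₁ V0 V1 T) : V1 * x ∈ wordSpan u₁ V0 V1 T := by
  rw [show V1 * x = (V1 + 1) * x - x by rw [add_mul, one_mul, add_sub_cancel_right]]
  exact sub_mem (h.one_add_V1_mul_mem hu₁ hx) hx

theorem V0_mul_twoSidedPow_mem (h : HRelations q r u₀ u₁ V0 V1 V0c T) (hu₁ : u₁ ≠ 0) (n : ℤ) :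
    V0 * twoSidedPow (elY V0 T) (elZ u₁ V0 T) n ∈ wordSpan u₁ V0 V1 T := by
  have h1 : elY V0 T * twoSidedPow (elY V0 T) (elZ u₁ V0 T) n ∈ wordSpan u₁ V0 V1 T := by
    rw [mul_twoSidedPow_left h.elY_mul_elZ]
    split_ifs
    · exact twoSidedPow_mem _
    · exact zero_mem _
  rw [show V0 * twoSidedPow (elY V0 T) (elZ u₁ V0 T) n =
    (T * elY V0 T - (u₁ - u₁⁻¹) • elY V0 T) * twoSidedPow (elY V0 T) (elZ u₁ V0 T) n by
      rw [← h.V0_eq hu₁], sub_mul, smul_mul_assoc, mul_assoc]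
  exact sub_mem (h.V1c_mul_mem hu₁ h1) (Submodule.smul_mem _ _ h1)

/-- Passing `V₀` through a letter `X` or `W` leaves `V₀` acting on a shorter word, multiplied by
elements already known to preserve the span. The base cases `V₀ Y^(n)` and `V₀ T Y^(n)` reduce to
the actions of `Y` and `Z` on `Y^(n)`. -/
theorem V0_mul_mem (h : HRelations q r u₀ u₁ V0 V1 V0c T) (hu₁ : u₁ ≠ 0) (hq : q ≠ 0)
    (hk : r * u₀⁻¹ ≠ 0) {x : R}
    (hx : x ∈ wordSpan u₁ V0 V1 T) : V0 * x ∈ wordSpan u₁ V0 V1 T := by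
  refine mul_mem_wordSpan (normalWord_induction (p := fun y => V0 * y ∈ wordSpan u₁ V0 V1 T)
    ?_ ?_ ?_ ?_) hx
  · exact h.V0_mul_twoSidedPow_mem hu₁
  · intro n
    have hZ : elZ u₁ V0 T * twoSidedPow (elY V0 T) (elZ u₁ V0 T) n ∈ wordSpan u₁ V0 V1 T := by
      rw [mul_twoSidedPow_right (h.elZ_mul_elY hu₁)]
      split_ifs
      · exact twoSidedPow_mem _
      · exact zero_mem _
    rw [← mul_assoc, h.V0_mul_V1c hu₁, sub_mul, add_mul, smul_mul_assoc, add_mul, one_mul]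
    exact sub_mem (add_mem (Submodule.smul_mem _ _
      (add_mem (h.V0_mul_twoSidedPow_mem hu₁ n) (twoSidedPow_mem n))) hZ)
      (h.V1c_mul_mem hu₁ (twoSidedPow_mem n))
  · intro m ε n ih
    have hw := normalWord_mem u₁ V0 V1 T m ε n
    rw [← mul_assoc, h.V0_mul_elX hu₁, sub_mul, sub_mul, smul_mul_assoc, smul_mul_assoc, one_mul,
      mul_assoc, mul_assoc]
    exact sub_mem (sub_mem (Submodule.smul_mem _ _ (h.V1c_mul_mem hu₁ (h.V1_mul_mem hu₁ ih)))
      (Submodule.smul_mem _ _ hw)) (h.elX_mul_mem hu₁ hw)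
  · intro m ε n ih
    have hw := normalWord_mem u₁ V0 V1 T m ε n
    have hw' := add_mem ih hw
    rw [← mul_assoc, h.V0_mul_elW hu₁ hq hk, smul_mul_assoc, add_mul, smul_mul_assoc, one_mul,
      mul_assoc, mul_assoc, add_mul V0, one_mul, invV1c_eq, sub_mul, smul_mul_assoc, one_mul]
    exact Submodule.smul_mem _ _ (add_mem (h.one_add_V1_mul_mem hu₁
      (sub_mem (h.V1c_mul_mem hu₁ hw') (Submodule.smul_mem _ _ hw'))) (Submodule.smul_mem _ _ hw))

theorem V0c_mul_mem (h : HRelations q r u₀ u₁ V0 V1 V0c T) (hu₁ : u₁ ≠ 0) (hq : q ≠ 0)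
    (hk : r * u₀⁻¹ ≠ 0) {x : R}
    (hx : x ∈ wordSpan u₁ V0 V1 T) : V0c * x ∈ wordSpan u₁ V0 V1 T := by
  have h1 : V0c = r • (T * V1 * V0) - u₀⁻¹ • 1 := by
    rw [h.triple, Algebra.algebraMap_eq_smul_one, add_sub_cancel_right]
  rw [h1, sub_mul, smul_mul_assoc, smul_mul_assoc, one_mul, mul_assoc, mul_assoc]
  exact sub_mem (Submodule.smul_mem _ _ (h.V1c_mul_mem hu₁ (h.V1_mul_mem hu₁
    (h.V0_mul_mem hu₁ hq hk hx)))) (Submodule.smul_mem _ _ hx)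

/-- Elements satisfying the relations define a homomorphism from `H_IV`. -/
theorem exists_algHom (h : HRelations q r u₀ u₁ V0 V1 V0c T) :
    ∃ F : HIV q r u₀ u₁ →ₐ[ℂ] R, F (gen q r u₀ u₁ HGen.V0) = V0 ∧
      F (gen q r u₀ u₁ HGen.V1) = V1 ∧ F (gen q r u₀ u₁ HGen.V0c) = V0c ∧
      F (gen q r u₀ u₁ HGen.V1c) = T := by
  let g : HGen → R := fun
    | .V0 => V0
    | .V1 => V1
    | .V0c => V0c
    | .V1c => T
  have hg : ∀ ⦃a b⦄, HRel q r u₀ u₁ a b → FreeAlgebra.lift ℂ g a = FreeAlgebra.lift ℂ g b := by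
    intro a b hab
    cases hab with
    | quad_V0 => simpa [g] using h.quad_V0
    | quad_V1 => simpa [g] using h.quad_V1
    | quad_V0c => simpa [g] using h.quad_V0c
    | quad_V1c =>
      simpa only [map_mul, map_sub, map_add, map_zero, AlgHom.commutes, FreeAlgebra.lift_ι_apply]
        using h.quad_V1c
    | triple =>
      simpa only [map_mul, map_smul, map_add, AlgHom.commutes, FreeAlgebra.lift_ι_apply]
        using h.triple
    | triple_zero =>
      simpa only [map_mul, map_zero, FreeAlgebra.lift_ι_apply] using h.triple_zero
    | double_zero =>
      simpa only [map_mul, map_zero, FreeAlgebra.lift_ι_apply] using h.double_zero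
    | lusztig_demazure =>
      simpa only [elX, elY, map_mul, map_sub, map_add, map_smul, map_pow, map_one,
        AlgHom.commutes, FreeAlgebra.lift_ι_apply] using h.lusztig_demazure
  refine ⟨RingQuot.liftAlgHom ℂ ⟨FreeAlgebra.lift ℂ g, hg⟩, ?_, ?_, ?_, ?_⟩ <;>
    simp [gen, g]

end HRelations

/-- The elements that preserve the span under left multiplication form a subalgebra, so it is enough
to treat the generators. -/
theorem mul_mem_wordSpan_gen (hu₁ : u₁ ≠ 0) (hq : q ≠ 0) (hk : r * u₀⁻¹ ≠ 0)
    (a : HIV q r u₀ u₁) :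
    ∀ x ∈ wordSpan u₁ (gen q r u₀ u₁ HGen.V0) (gen q r u₀ u₁ HGen.V1) (gen q r u₀ u₁ HGen.V1c),
      a * x ∈
        wordSpan u₁ (gen q r u₀ u₁ HGen.V0) (gen q r u₀ u₁ HGen.V1) (gen q r u₀ u₁ HGen.V1c) := by
  have h := gen_relations q r u₀ u₁
  obtain ⟨b, rfl⟩ := RingQuot.mkAlgHom_surjective ℂ (HRel q r u₀ u₁) a
  induction b using FreeAlgebra.induction with
  | grade0 c =>
    intro x hx
    rw [AlgHom.commutes, ← Algebra.smul_def]
    exact Submodule.smul_mem _ _ hx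
  | grade1 g =>
    intro x hx
    cases g with
    | V0 => exact h.V0_mul_mem hu₁ hq hk hx
    | V1 => exact h.V1_mul_mem hu₁ hx
    | V0c => exact h.V0c_mul_mem hu₁ hq hk hx
    | V1c => exact h.V1c_mul_mem hu₁ hx
  | mul a b ha hb =>
    intro x hx
    rw [map_mul, mul_assoc]
    exact ha _ (hb _ hx)
  | add a b ha hb =>
    intro x hx
    rw [map_add, add_mul]
    exact add_mem (ha _ hx) (hb _ hx)

/-- The words span the algebra `H_IV`. -/
theorem span_word_eq_top (hu₁ : u₁ ≠ 0) (hq : q ≠ 0) (hk : r * u₀⁻¹ ≠ 0) :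
    Submodule.span ℂ (Set.range fun w : ℤ × Fin 2 × ℤ => word q r u₀ u₁ w.1 w.2.1 w.2.2) = ⊤ := by
  have h1 : (fun w : ℤ × Fin 2 × ℤ => word q r u₀ u₁ w.1 w.2.1 w.2.2) = fun w =>
      normalWord u₁ (gen q r u₀ u₁ HGen.V0) (gen q r u₀ u₁ HGen.V1) (gen q r u₀ u₁ HGen.V1c)
        w.1 w.2.1 w.2.2 :=
    funext fun w => map_word (AlgHom.id ℂ _) w.1 w.2.1 w.2.2
  rw [h1, eq_top_iff]
  intro a _
  have h2 := mul_mem_wordSpan_gen hu₁ hq hk a 1 (by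
    have := normalWord_mem u₁ (gen q r u₀ u₁ HGen.V0) (gen q r u₀ u₁ HGen.V1)
      (gen q r u₀ u₁ HGen.V1c) 0 0 0
    simpa [normalWord, twoSidedPow] using this)
  rwa [mul_one] at h2

theorem injective_of_linearIndependent_word {A : Type*} [Ring A] [Algebra ℂ A] (hu₁ : u₁ ≠ 0)
    (hq : q ≠ 0) (hk : r * u₀⁻¹ ≠ 0) (F : HIV q r u₀ u₁ →ₐ[ℂ] A)
    (hF : LinearIndependent ℂ fun w : ℤ × Fin 2 × ℤ => F (word q r u₀ u₁ w.1 w.2.1 w.2.2)) :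
    Function.Injective F := by
  rw [injective_iff_map_eq_zero]
  intro a ha
  have h1 : a ∈ Submodule.span ℂ
      (Set.range fun w : ℤ × Fin 2 × ℤ => word q r u₀ u₁ w.1 w.2.1 w.2.2) := by
    rw [span_word_eq_top hu₁ hq hk]; trivial
  obtain ⟨c, rfl⟩ := Finsupp.mem_span_range_iff_exists_finsupp.1 h1
  have h2 := linearIndependent_iff.1 hF c (by
    rw [← ha, Finsupp.linearCombination_apply, Finsupp.sum, Finsupp.sum, map_sum]
    exact Finset.sum_congr rfl fun w _ => (map_smul F _ _).symm)
  rw [h2, Finsupp.sum_zero_index]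

end Words

/-! ### Criteria for linear independence. -/

section Triangularity

/-- A family is linearly independent if every finite nonempty set of indices contains an index
which is separated from the others by a linear functional. -/
theorem linearIndependent_of_functional {ι U : Type*} [AddCommGroup U] [Module ℂ U] {f : ι → U}
    (h : ∀ s : Finset ι, s.Nonempty →
      ∃ i ∈ s, ∃ l : U →ₗ[ℂ] ℂ, l (f i) ≠ 0 ∧ ∀ k ∈ s, k ≠ i → l (f k) = 0) :
    LinearIndependent ℂ f := by
  classical
  rw [linearIndependent_iff]
  intro c hc
  by_contra hne
  obtain ⟨i, hi, l, hl, hl'⟩ := h c.support (Finsupp.support_nonempty_iff.2 hne)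
  have h1 := congrArg l hc
  rw [Finsupp.linearCombination_apply, Finsupp.sum, map_sum, map_zero,
    Finset.sum_eq_single_of_mem i hi
      (fun k hk hki => by rw [map_smul, hl' k hk hki, smul_zero]), map_smul, smul_eq_mul] at h1
  exact mul_ne_zero (Finsupp.mem_support_iff.1 hi) hl h1

theorem linearIndependent_of_rank {ι U L : Type*} [AddCommGroup U] [Module ℂ U] [LinearOrder L]
    {f : ι → U} (ρ : ι → L) (hρ : Function.Injective ρ)
    (h : ∀ i, ∃ l : U →ₗ[ℂ] ℂ, l (f i) ≠ 0 ∧ ∀ k, ρ k < ρ i → l (f k) = 0) :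
    LinearIndependent ℂ f := by
  refine linearIndependent_of_functional fun s hs => ?_
  obtain ⟨i, hi, hmax⟩ := s.exists_max_image ρ hs
  obtain ⟨l, hl, hl'⟩ := h i
  exact ⟨i, hi, l, hl, fun k hk hki => hl' k (lt_of_le_of_ne (hmax k hk) (hρ.ne hki))⟩

/-- Products `P i * Q n` of operators are linearly independent if the `P i` are independent on a
vector `w` and there are test vectors `x n` for which the `Q n (x k)` form a triangular matrix
of multiples of `w`. -/
theorem linearIndependent_mul_of_triangular {ι κ U : Type*} [AddCommGroup U] [Module ℂ U]
    {P : ι → Module.End ℂ U} {Q : κ → Module.End ℂ U} {w : U} (ρ : κ → ℕ) (x : κ → U)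
    (hP : LinearIndependent ℂ fun i => P i w)
    (hQ : ∀ n, ∃ c : ℂ, c ≠ 0 ∧ Q n (x n) = c • w)
    (hQ0 : ∀ n k, ρ k ≤ ρ n → n ≠ k → Q n (x k) = 0) :
    LinearIndependent ℂ fun a : ι × κ => P a.1 * Q a.2 := by
  classical
  rw [linearIndependent_iff]
  intro c hc
  by_contra hne
  -- With `ρ k` minimal on the support, every other `Q n` occurring there kills `x k`; evaluation at
  -- `x k` leaves a relation among the `P i w` alone.
  obtain ⟨⟨i, k⟩, hi, hmin⟩ := c.support.exists_min_image (fun a => ρ a.2)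
    (Finsupp.support_nonempty_iff.2 hne)
  obtain ⟨d, hd, hdk⟩ := hQ k
  have h1 : ∑ a ∈ c.support, c a • P a.1 (Q a.2 (x k)) = 0 := by
    have := congrArg (fun M : Module.End ℂ U => M (x k)) hc
    simpa [Finsupp.linearCombination_apply, Finsupp.sum] using this
  have h2 : ∑ a ∈ c.support with a.2 = k, (d * c a) • P a.1 w = 0 := by
    rw [← h1, Finset.sum_filter]
    refine Finset.sum_congr rfl fun a ha => ?_
    split_ifs with hak
    · rw [hak, hdk, map_smul, smul_smul, mul_comm]
    · rw [hQ0 _ _ (hmin a ha) hak, map_zero, smul_zero]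
  have h3 : LinearIndepOn ℂ (fun a : ι × κ => P a.1 w) {a | a.2 = k} := by
    refine LinearIndependent.comp hP (fun a : {a : ι × κ | a.2 = k} => a.1.1) ?_
    rintro ⟨⟨a, b⟩, hb⟩ ⟨⟨a', b'⟩, hb'⟩ h
    simp only [Set.mem_ofPred_eq] at hb hb' h
    subst hb hb' h
    rfl
  have h4 := linearIndepOn_iff'.1 h3 _ (fun a => d * c a) (by simp) h2 (i, k) (by simpa using hi)
  exact mul_ne_zero hd (Finsupp.mem_support_iff.1 hi) h4

end Triangularity

/-! ### A representation of the torus on functions on `ℤ`. -/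

section Representation

/-- The operator `φ ↦ (j ↦ a j * φ (j + d))`. -/
def weightedShift (a : ℤ → ℂ) (d : ℤ) : Module.End ℂ (ℤ → ℂ) where
  toFun φ j := a j * φ (j + d)
  map_add' φ ψ := by ext j; simp [mul_add]
  map_smul' c φ := by ext j; simp [mul_left_comm]

@[simp]
theorem weightedShift_apply (a : ℤ → ℂ) (d : ℤ) (φ : ℤ → ℂ) (j : ℤ) :
    weightedShift a d φ j = a j * φ (j + d) := rfl

variable (q r u₀ : ℂ)

/-- The operators representing the generators of the quantum torus. -/
def torusOp : TorusGen → Module.End ℂ (ℤ → ℂ)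
  | .pos 0 => weightedShift (fun _ => 1) 1
  | .pos 1 => weightedShift (fun j => -(r * u₀)⁻¹ * q ^ (1 - j)) (-1)
  -- The factor `i` makes `1 + i e^{S₃}` act as `1 - q ^ j`, which vanishes at `j = 0`. The weight
  -- of `e^{S₂}` is then forced by the value of `e^{S₁} e^{S₂} e^{S₃}`.
  | .pos 2 => weightedShift (fun j => Complex.I * q ^ j) 0
  | .neg 0 => weightedShift (fun _ => 1) (-1)
  | .neg 1 => weightedShift (fun j => -(r * u₀) * q ^ j) 1
  | .neg 2 => weightedShift (fun j => -Complex.I * q ^ (-j)) 0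

variable {q r u₀}

theorem torusOp_rel (hq : q ≠ 0) (hr : r ≠ 0) (hu₀ : u₀ ≠ 0) ⦃a b : FreeAlgebra ℂ TorusGen⦄
    (h : TorusRel q r u₀ a b) :
    FreeAlgebra.lift ℂ (torusOp q r u₀) a = FreeAlgebra.lift ℂ (torusOp q r u₀) b := by
  cases h with
  | pos_neg i =>
    ext φ j
    fin_cases i <;> simp [torusOp, zpow_sub₀ hq, zpow_add₀ hq] <;> field_simp <;> simp
  | neg_pos i =>
    ext φ j
    fin_cases i <;> simp [torusOp, zpow_sub₀ hq, zpow_add₀ hq] <;> field_simp <;> simp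
  | comm i =>
    ext φ j
    fin_cases i <;> simp [torusOp, zpow_sub₀ hq, zpow_add₀ hq] <;> field_simp
  | total =>
    ext φ j
    simp [torusOp, zpow_sub₀ hq, zpow_add₀ hq]
    field_simp

/-- The representation of the quantum torus on functions on `ℤ`. -/
def torusRep (hq : q ≠ 0) (hr : r ≠ 0) (hu₀ : u₀ ≠ 0) :
    QTorus q r u₀ →ₐ[ℂ] Module.End ℂ (ℤ → ℂ) :=
  RingQuot.liftAlgHom ℂ ⟨FreeAlgebra.lift ℂ (torusOp q r u₀), torusOp_rel hq hr hu₀⟩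

theorem torusRep_expS (hq : q ≠ 0) (hr : r ≠ 0) (hu₀ : u₀ ≠ 0) (i : Fin 3) :
    torusRep hq hr hu₀ (expS q r u₀ i) = torusOp q r u₀ (.pos i) := by
  simp [torusRep, expS]

theorem torusRep_expNegS (hq : q ≠ 0) (hr : r ≠ 0) (hu₀ : u₀ ≠ 0) (i : Fin 3) :
    torusRep hq hr hu₀ (expNegS q r u₀ i) = torusOp q r u₀ (.neg i) := by
  simp [torusRep, expNegS]

/-- The induced representation of the matrix algebra on pairs of functions on `ℤ`. -/
def matRep (hq : q ≠ 0) (hr : r ≠ 0) (hu₀ : u₀ ≠ 0) :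
    Matrix (Fin 2) (Fin 2) (QTorus q r u₀) →ₐ[ℂ] Module.End ℂ (Fin 2 → ℤ → ℂ) :=
  (endVecAlgEquivMatrixEnd (Fin 2) ℂ ℂ (ℤ → ℂ)).symm.toAlgHom.comp
    (AlgHom.mapMatrix (torusRep hq hr hu₀))

theorem matRep_apply (hq : q ≠ 0) (hr : r ≠ 0) (hu₀ : u₀ ≠ 0)
    (M : Matrix (Fin 2) (Fin 2) (QTorus q r u₀)) (φ : Fin 2 → ℤ → ℂ) (i : Fin 2) :
    matRep hq hr hu₀ M φ i =
      torusRep hq hr hu₀ (M i 0) (φ 0) + torusRep hq hr hu₀ (M i 1) (φ 1) := by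
  change ∑ j, torusRep hq hr hu₀ (M i j) (φ j) = _
  rw [Fin.sum_univ_two]

/-- Explicit formulas for operators `V₀`, `V₁`, `T` on pairs of functions on `ℤ`. -/
structure ActsOnPairs (q c u₁ : ℂ) (V0 V1 T : Module.End ℂ (Fin 2 → ℤ → ℂ)) : Prop where
  V0_zero (φ j) : V0 φ 0 j = -φ 0 j
  V0_one (φ j) : V0 φ 1 j = (1 - q ^ j) * φ 0 j
  V1_zero (φ j) : V1 φ 0 j =
    -(φ 0 j + φ 1 j) + Complex.I * c * q ^ (1 - j) * (φ 0 (j - 1) + φ 1 (j - 1))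
  V1_one (φ j) : V1 φ 1 j = -Complex.I * c * q ^ (1 - j) * (φ 0 (j - 1) + φ 1 (j - 1))
  T_zero (φ j) : T φ 0 j = -Complex.I * φ 1 (j + 1)
  T_one (φ j) : T φ 1 j = Complex.I * φ 0 (j - 1) + (u₁ - u₁⁻¹) * φ 1 j

theorem matRep_actsOnPairs (hq : q ≠ 0) (hr : r ≠ 0) (hu₀ : u₀ ≠ 0) (u₁ : ℂ) :
    ActsOnPairs q (r * u₀)⁻¹ u₁ (matRep hq hr hu₀ (matV0 q r u₀))
      (matRep hq hr hu₀ (matV1 q r u₀)) (matRep hq hr hu₀ (matV1c q r u₀ u₁)) where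
  V0_zero φ j := by
    rw [matRep_apply]
    simp [matV0]
  V0_one φ j := by
    rw [matRep_apply]
    simp [matV0, torusRep_expS, torusOp]
    linear_combination q ^ j * φ 0 j * Complex.I_mul_I
  V1_zero φ j := by
    rw [matRep_apply]
    simp [matV1, torusRep_expS, torusOp, ← sub_eq_add_neg]
    ring
  V1_one φ j := by
    rw [matRep_apply]
    simp [matV1, torusRep_expS, torusOp, ← sub_eq_add_neg]
    ring
  T_zero φ j := by
    rw [matRep_apply]
    simp [matV1c, torusRep_expS, torusOp]
  T_one φ j := by
    rw [matRep_apply]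
    simp [matV1c, torusRep_expNegS, torusOp, Algebra.algebraMap_eq_smul_one, ← sub_eq_add_neg]

end Representation

/-! ### Leading indices of functions on `ℤ`. -/

section LeadingIndex

/-- `d` is the largest index at which `g` does not vanish. -/
def IsLead (g : ℤ → ℂ) (d : ℤ) : Prop := g d ≠ 0 ∧ ∀ j, d < j → g j = 0

theorem isLead_single (d : ℤ) : IsLead (Pi.single d 1) d :=
  ⟨by simp, fun _ hj => Pi.single_eq_of_ne hj.ne' _⟩

/-- The action of `W` on the sum of the two components. -/
def sumOp (q c u₁ : ℂ) : Module.End ℂ (ℤ → ℂ) :=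
  weightedShift (fun j => -c * q ^ (-j)) 0 +
    weightedShift (fun j => -Complex.I - Complex.I * (u₁ - u₁⁻¹) * c * q ^ (1 - j)) (-1) +
    weightedShift (fun j => -c * q ^ (2 - j)) (-2)

theorem IsLead.apply_sumOp {q c : ℂ} (hq : q ≠ 0) (hc : c ≠ 0) (u₁ : ℂ) {g : ℤ → ℂ} {d : ℤ}
    (h : IsLead g d) : IsLead (sumOp q c u₁ g) (d + 2) := by
  constructor
  · have h1 : sumOp q c u₁ g (d + 2) = -c * q ^ (-d) * g d := by
      simp [sumOp, h.2 (d + 2) (by omega), h.2 (d + 2 + -1) (by omega)]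
    rw [h1]
    exact mul_ne_zero (mul_ne_zero (neg_ne_zero.2 hc) (zpow_ne_zero _ hq)) h.1
  · intro j hj
    simp [sumOp, h.2 j (by omega), h.2 (j + -1) (by omega), h.2 (j + -2) (by omega)]

theorem IsLead.iterate_sumOp {q c : ℂ} (hq : q ≠ 0) (hc : c ≠ 0) (u₁ : ℂ) {g : ℤ → ℂ} {d : ℤ}
    (h : IsLead g d) (k : ℕ) : IsLead ((sumOp q c u₁ ^ k) g) (d + 2 * k) := by
  induction k with
  | zero => simpa using h
  | succ k ih =>
    rw [pow_succ', show d + 2 * ((k + 1 : ℕ) : ℤ) = d + 2 * k + 2 by push_cast; ring]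
    exact ih.apply_sumOp hq hc u₁

end LeadingIndex

/-- The vector `(0, δ₁)`. -/
def cyclicVec : Fin 2 → ℤ → ℂ := ![0, Pi.single 1 1]

/-- The vectors on which the operators `Y ^ n` and `Z ^ n` are tested. -/
def testVec (Y : Module.End ℂ (Fin 2 → ℤ → ℂ)) (n : ℤ) : Fin 2 → ℤ → ℂ :=
  -- For `n ≥ 0` the extra `Y` ensures that `Z` kills the vector, as `ZY = 0`; for `n < 0` the zero
  -- first component ensures that `Y` does.
  if 0 ≤ n then Y ![Pi.single n 1, 0] else ![0, Pi.single (1 - n) 1]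

/-- The order in which the vectors `X^(m) T^ε w` become triangular. -/
def wordRank (a : ℤ × Fin 2) : ℕ ×ₗ ℕ :=
  -- The words with `m ≥ 1` rank lowest: adding the two components annihilates their vectors, so
  -- functionals factoring through this sum isolate the words with `m ≤ 0`.
  if 1 ≤ a.1 then toLex (0, 2 * a.1.toNat + a.2) else toLex (1, 2 * (-a.1).toNat + a.2)

theorem wordRank_injective : Function.Injective wordRank := by
  rintro ⟨m, ε⟩ ⟨m', ε'⟩ h
  unfold wordRank at h
  have h1 := ε.isLt
  have h2 := ε'.isLt
  split_ifs at h <;> simp only [EmbeddingLike.apply_eq_iff_eq, Prod.mk.injEq] at h <;>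
    (try simp at h) <;> refine Prod.ext (by simp only at *; omega) (Fin.ext (by simp only at *; omega))

/-! ### Explicit action of `X`, `W`, `Y`, `Z` on pairs of functions. -/

namespace ActsOnPairs

variable {q c u₁ : ℂ} {V0 V1 T : Module.End ℂ (Fin 2 → ℤ → ℂ)}

theorem elY_zero (h : ActsOnPairs q c u₁ V0 V1 T) (φ j) :
    elY V0 T φ 0 j = -Complex.I * (1 - q ^ (j + 1)) * φ 0 (j + 1) := by
  rw [elY, Module.End.mul_apply, h.T_zero, h.V0_one]; ring

theorem elY_one (h : ActsOnPairs q c u₁ V0 V1 T) (φ j) :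
    elY V0 T φ 1 j = -Complex.I * φ 0 (j - 1) + (u₁ - u₁⁻¹) * (1 - q ^ j) * φ 0 j := by
  rw [elY, Module.End.mul_apply, h.T_one, h.V0_one, h.V0_zero]; ring

theorem inv_zero (h : ActsOnPairs q c u₁ V0 V1 T) (φ j) :
    invV1c u₁ T φ 0 j = -(u₁ - u₁⁻¹) * φ 0 j - Complex.I * φ 1 (j + 1) := by
  rw [invV1c_eq]
  simp [h.T_zero]
  ring

theorem inv_one (h : ActsOnPairs q c u₁ V0 V1 T) (φ j) :
    invV1c u₁ T φ 1 j = Complex.I * φ 0 (j - 1) := by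
  rw [invV1c_eq]
  simp [h.T_one]

theorem elZ_zero (h : ActsOnPairs q c u₁ V0 V1 T) (φ j) : elZ u₁ V0 T φ 0 j = 0 := by
  change (V0 + 1) (invV1c u₁ T φ) 0 j = 0
  simp [h.V0_zero]

theorem elZ_one (h : ActsOnPairs q c u₁ V0 V1 T) (φ j) :
    elZ u₁ V0 T φ 1 j =
      (1 - q ^ j) * (-(u₁ - u₁⁻¹) * φ 0 j - Complex.I * φ 1 (j + 1)) +
        Complex.I * φ 0 (j - 1) := by
  change (V0 + 1) (invV1c u₁ T φ) 1 j = _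
  simp [h.V0_one, h.inv_zero, h.inv_one]

/-- The two rows of the matrix of `V₁ + 1` are opposite. -/
theorem elX_one (h : ActsOnPairs q c u₁ V0 V1 T) (φ j) :
    elX u₁ V1 T φ 1 j = -(elX u₁ V1 T φ 0 j) := by
  change (V1 + 1) (invV1c u₁ T φ) 1 j = -((V1 + 1) (invV1c u₁ T φ) 0 j)
  simp only [LinearMap.add_apply, Pi.add_apply, Module.End.one_apply, h.V1_one, h.V1_zero]
  ring

theorem elX_zero (h : ActsOnPairs q c u₁ V0 V1 T) (φ j) :
    elX u₁ V1 T φ 0 j =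
      Complex.I * c * q ^ (1 - j) * (-(u₁ - u₁⁻¹) * φ 0 (j - 1) - Complex.I * φ 1 j +
        Complex.I * φ 0 (j - 2)) - Complex.I * φ 0 (j - 1) := by
  change (V1 + 1) (invV1c u₁ T φ) 0 j = _
  simp only [LinearMap.add_apply, Pi.add_apply, Module.End.one_apply, h.V1_zero, h.inv_zero,
    h.inv_one, sub_add_cancel, sub_sub, one_add_one_eq_two]
  ring

/-- The two columns of the matrix of `V₁` coincide, so `W` depends on a pair only through the sum of
its components and induces an operator on such sums. -/
theorem elW_sum (h : ActsOnPairs q c u₁ V0 V1 T) (φ) :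
    elW V1 T φ 0 + elW V1 T φ 1 = sumOp q c u₁ (φ 0 + φ 1) := by
  ext j
  rw [elW, Pi.add_apply, Module.End.mul_apply, h.T_zero, h.T_one, h.V1_one, h.V1_one, h.V1_zero]
  simp only [sumOp, LinearMap.add_apply, Pi.add_apply, weightedShift_apply, ← sub_eq_add_neg,
    sub_sub, one_add_one_eq_two, add_sub_cancel_right, add_zero,
    show (1 : ℤ) - (j + 1) = -j by ring, show (1 : ℤ) - (j - 1) = 2 - j by ring]
  linear_combination (c * q ^ (2 - j) * (φ 0 (j - 2) + φ 1 (j - 2)) +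
    c * q ^ (-j) * (φ 0 j + φ 1 j)) * Complex.I_mul_I

theorem elW_pow_sum (h : ActsOnPairs q c u₁ V0 V1 T) (k : ℕ) (φ) :
    (elW V1 T ^ k) φ 0 + (elW V1 T ^ k) φ 1 = (sumOp q c u₁ ^ k) (φ 0 + φ 1) := by
  induction k with
  | zero => rfl
  | succ k ih =>
    rw [pow_succ', pow_succ', Module.End.mul_apply, h.elW_sum, ih, Module.End.mul_apply]

/-! ### Independence of the vectors `X^(m) T^ε w` -/

/-- On pairs `(g, -g)` the term of `X` with the largest shift is a nonzero multiple of `g (j - 2)`.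
-/
theorem isLead_elX (h : ActsOnPairs q c u₁ V0 V1 T) (hq : q ≠ 0) (hc : c ≠ 0)
    {φ : Fin 2 → ℤ → ℂ} {d : ℤ} (hφ : φ 1 = -φ 0) (hd : IsLead (φ 0) d) :
    IsLead (elX u₁ V1 T φ 0) (d + 2) := by
  constructor
  · rw [h.elX_zero, hφ, Pi.neg_apply, hd.2 (d + 2 - 1) (by omega), hd.2 (d + 2) (by omega),
      add_sub_cancel_right]
    have : Complex.I * c * q ^ (1 - (d + 2)) * (Complex.I * φ 0 d) ≠ 0 :=
      mul_ne_zero (mul_ne_zero (mul_ne_zero Complex.I_ne_zero hc) (zpow_ne_zero _ hq))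
        (mul_ne_zero Complex.I_ne_zero hd.1)
    simpa using this
  · intro j hj
    rw [h.elX_zero, hφ, Pi.neg_apply, hd.2 (j - 1) (by omega), hd.2 j (by omega),
      hd.2 (j - 2) (by omega)]
    simp

theorem isLead_elX_cyclicVec (h : ActsOnPairs q c u₁ V0 V1 T) (hq : q ≠ 0) (hc : c ≠ 0)
    (ε : Fin 2) : IsLead (elX u₁ V1 T ((T ^ (ε : ℕ)) cyclicVec) 0) (1 + (ε : ℕ)) := by
  fin_cases ε
  · have h1 : ∀ j, elX u₁ V1 T cyclicVec 0 j =
        c * q ^ (1 - j) * (Pi.single 1 1 : ℤ → ℂ) j := by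
      intro j
      rw [h.elX_zero]
      simp only [cyclicVec, Matrix.cons_val_zero, Matrix.cons_val_one, Pi.zero_apply]
      linear_combination -c * q ^ (1 - j) * (Pi.single 1 1 : ℤ → ℂ) j * Complex.I_mul_I
    refine ⟨?_, fun j hj => ?_⟩
    · simpa [h1] using hc
    · have : j ≠ 1 := by simp at hj; omega
      simp [h1, this]
  · have h1 : ∀ j, elX u₁ V1 T (T cyclicVec) 0 j =
        Complex.I * c * q ^ (1 - j) * (Pi.single 2 1 : ℤ → ℂ) j -
          (Pi.single 1 1 : ℤ → ℂ) j := by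
      intro j
      rw [h.elX_zero]
      simp only [h.T_zero, h.T_one]
      simp only [cyclicVec, Matrix.cons_val_zero, Matrix.cons_val_one, Pi.zero_apply,
        sub_add_cancel, show j - 2 + 1 = j - 1 by ring,
        show (Pi.single 1 1 : ℤ → ℂ) (j - 1) = (Pi.single 2 1 : ℤ → ℂ) j by
          simp only [Pi.single_apply]; congr 1; simp only [eq_iff_iff]; omega]
      linear_combination (-Complex.I * c * q ^ (1 - j) * (Pi.single 2 1 : ℤ → ℂ) j +
        (Pi.single 1 1 : ℤ → ℂ) j) * Complex.I_mul_I
    refine ⟨?_, fun j hj => ?_⟩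
    · simpa [h1] using ⟨hc, hq⟩
    · change (1 : ℤ) + ((1 : ℕ) : ℤ) < j at hj
      have h2 : j ≠ 1 := by omega
      have h3 : j ≠ 2 := by omega
      simp [h1, h2, h3]

theorem isLead_elX_pow (h : ActsOnPairs q c u₁ V0 V1 T) (hq : q ≠ 0) (hc : c ≠ 0)
    (ε : Fin 2) (k : ℕ) :
    IsLead ((elX u₁ V1 T ^ (k + 1)) ((T ^ (ε : ℕ)) cyclicVec) 0) (2 * k + 1 + (ε : ℕ)) := by
  induction k with
  | zero => simpa using h.isLead_elX_cyclicVec hq hc ε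
  | succ k ih =>
    rw [pow_succ', Module.End.mul_apply, show 2 * ((k + 1 : ℕ) : ℤ) + 1 + (ε : ℕ) =
      2 * k + 1 + (ε : ℕ) + 2 by push_cast; ring]
    refine h.isLead_elX hq hc ?_ ih
    ext j
    rw [pow_succ', Module.End.mul_apply, Pi.neg_apply, h.elX_one]

theorem elX_pow_sum (h : ActsOnPairs q c u₁ V0 V1 T) (k : ℕ) (φ) :
    (elX u₁ V1 T ^ (k + 1)) φ 0 + (elX u₁ V1 T ^ (k + 1)) φ 1 = 0 := by
  ext j
  rw [pow_succ', Module.End.mul_apply, Pi.add_apply, h.elX_one]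
  simp

theorem T_cyclicVec_sum (h : ActsOnPairs q c u₁ V0 V1 T) :
    T cyclicVec 0 + T cyclicVec 1 =
      -Complex.I • (Pi.single 0 1 : ℤ → ℂ) + (u₁ - u₁⁻¹) • (Pi.single 1 1 : ℤ → ℂ) := by
  ext j
  simp only [Pi.add_apply, h.T_zero, h.T_one]
  simp [cyclicVec, Pi.single_apply]

theorem linearIndependent_cyclicVec (h : ActsOnPairs q c u₁ V0 V1 T) (hq : q ≠ 0) (hc : c ≠ 0) :
    LinearIndependent ℂ fun a : ℤ × Fin 2 =>
      (twoSidedPow (elX u₁ V1 T) (elW V1 T) a.1 * T ^ (a.2 : ℕ)) cyclicVec := by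
  refine linearIndependent_of_rank wordRank wordRank_injective ?_
  let S : (Fin 2 → ℤ → ℂ) →ₗ[ℂ] ℤ → ℂ :=
    (LinearMap.proj 0 : (Fin 2 → ℤ → ℂ) →ₗ[ℂ] ℤ → ℂ) + LinearMap.proj 1
  have hS : ∀ φ, S φ = φ 0 + φ 1 := fun _ => rfl
  have hpos : ∀ m ε, 1 ≤ m →
      S ((twoSidedPow (elX u₁ V1 T) (elW V1 T) m * T ^ ((ε : Fin 2) : ℕ)) cyclicVec) = 0 := by
    intro m ε hm
    obtain ⟨k, rfl⟩ : ∃ k : ℕ, m = ((k + 1 : ℕ) : ℤ) := ⟨m.toNat - 1, by omega⟩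
    rw [twoSidedPow_natCast, hS, Module.End.mul_apply, h.elX_pow_sum]
  have hneg0 : ∀ k : ℕ, S ((twoSidedPow (elX u₁ V1 T) (elW V1 T) (-k) *
      T ^ ((0 : Fin 2) : ℕ)) cyclicVec) = (sumOp q c u₁ ^ k) (Pi.single 1 1) := by
    intro k
    rw [twoSidedPow_neg_natCast, hS, Module.End.mul_apply, h.elW_pow_sum]
    simp [cyclicVec]
  have hneg1 : ∀ k : ℕ, S ((twoSidedPow (elX u₁ V1 T) (elW V1 T) (-k) *
      T ^ ((1 : Fin 2) : ℕ)) cyclicVec) = -Complex.I • (sumOp q c u₁ ^ k) (Pi.single 0 1) +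
        (u₁ - u₁⁻¹) • (sumOp q c u₁ ^ k) (Pi.single 1 1) := by
    intro k
    rw [twoSidedPow_neg_natCast, hS, Module.End.mul_apply, h.elW_pow_sum, Fin.val_one, pow_one,
      h.T_cyclicVec_sum, map_add, map_smul, map_smul]
  have lead0 := fun k => (isLead_single 0).iterate_sumOp hq hc u₁ k
  have lead1 := fun k => (isLead_single 1).iterate_sumOp hq hc u₁ k
  -- For `k' < k` the sums have leading index at most `2 * k' + 1`, which is below `2 * k`.
  have hlow : ∀ (k k' : ℕ) (ε : Fin 2) (j : ℤ), k' < k → 2 * (k : ℤ) ≤ j →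
      S ((twoSidedPow (elX u₁ V1 T) (elW V1 T) (-k') * T ^ (ε : ℕ)) cyclicVec) j = 0 := by
    intro k k' ε j hk hj
    fin_cases ε
    · exact (congrFun (hneg0 k') j).trans ((lead1 k').2 j (by omega))
    · refine (congrFun (hneg1 k') j).trans ?_
      simp only [Pi.add_apply, Pi.smul_apply]
      rw [(lead0 k').2 j (by omega), (lead1 k').2 j (by omega), smul_zero, smul_zero, add_zero]
  rintro ⟨m, ε⟩
  by_cases hm : 1 ≤ m
  · obtain ⟨k, rfl⟩ : ∃ k : ℕ, m = ((k + 1 : ℕ) : ℤ) := ⟨m.toNat - 1, by omega⟩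
    refine ⟨LinearMap.proj (2 * k + 1 + (ε : ℕ) : ℤ) ∘ₗ LinearMap.proj 0, ?_, ?_⟩
    · rw [twoSidedPow_natCast]
      exact (h.isLead_elX_pow hq hc ε k).1
    · rintro ⟨m', ε'⟩ hlt
      by_cases hm' : 1 ≤ m'
      · obtain ⟨k', rfl⟩ : ∃ k : ℕ, m' = ((k + 1 : ℕ) : ℤ) := ⟨m'.toNat - 1, by omega⟩
        simp only [wordRank, hm, hm', if_true, Prod.Lex.toLex_lt_toLex, lt_irrefl, false_or,
          true_and, Int.toNat_natCast] at hlt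
        rw [twoSidedPow_natCast]
        exact (h.isLead_elX_pow hq hc ε' k').2 (2 * k + 1 + (ε : ℕ)) (by omega)
      · simp [wordRank, hm', Prod.Lex.toLex_lt_toLex] at hlt
  · obtain ⟨k, rfl⟩ : ∃ k : ℕ, m = -(k : ℤ) := ⟨(-m).toNat, by omega⟩
    have hrank : ∀ m' ε', ¬ 1 ≤ m' → wordRank (m', ε') < wordRank (-(k : ℤ), ε) →
        ∃ k' : ℕ, m' = -(k' : ℤ) ∧ 2 * k' + (ε' : ℕ) < 2 * k + (ε : ℕ) := by
      intro m' ε' hm' hlt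
      refine ⟨(-m').toNat, by omega, ?_⟩
      simpa only [wordRank, hm, hm', if_false, Prod.Lex.toLex_lt_toLex, lt_irrefl, false_or,
          true_and, neg_neg, Int.toNat_natCast] using hlt
    fin_cases ε
    · refine ⟨LinearMap.proj (1 + 2 * k : ℤ) ∘ₗ S, ?_, ?_⟩
      · change S _ (1 + 2 * (k : ℤ)) ≠ 0
        exact (congrFun (hneg0 k) _).trans_ne (lead1 k).1
      · rintro ⟨m', ε'⟩ hlt
        change S _ (1 + 2 * (k : ℤ)) = 0
        by_cases hm' : 1 ≤ m'
        · rw [hpos _ _ hm', Pi.zero_apply]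
        · obtain ⟨k', rfl, hk'⟩ := hrank _ _ hm' hlt
          exact hlow k k' ε' _ (by simp at hk'; omega) (by omega)
    · have hne := (lead1 k).1
      -- For `ε = 1` the sum combines images of `δ₀` and `δ₁`, with leading indices `2 * k` and `2 *
      -- k + 1`; the latter has coefficient `u₁ - u₁⁻¹`, possibly zero. Subtracting the multiple of
      -- the value at `2 * k + 1` makes the functional vanish on the image of `δ₁`, that is, on the
      -- word with `ε = 0`, and leaves the leading value of the image of `δ₀`.
      refine ⟨(LinearMap.proj (2 * k : ℤ) - ((sumOp q c u₁ ^ k) (Pi.single 1 1) (2 * k) /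
        (sumOp q c u₁ ^ k) (Pi.single 1 1) (1 + 2 * k)) • LinearMap.proj (1 + 2 * k : ℤ)) ∘ₗ S,
        ?_, ?_⟩
      · have h0 := (lead0 k).2 (1 + 2 * k) (by omega)
        have h0' := (lead0 k).1
        rw [zero_add] at h0'
        have h1 := hneg1 k
        simp only [Fin.val_one] at h1
        simp only [LinearMap.comp_apply, h1, LinearMap.sub_apply,
          LinearMap.smul_apply, LinearMap.proj_apply, Pi.add_apply, Pi.smul_apply, smul_eq_mul, h0]
        have h2 : -Complex.I * (sumOp q c u₁ ^ k) (Pi.single 0 1) (2 * k) ≠ 0 :=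
          mul_ne_zero (neg_ne_zero.2 Complex.I_ne_zero) h0'
        convert h2 using 1
        field_simp
        ring
      · rintro ⟨m', ε'⟩ hlt
        by_cases hm' : 1 ≤ m'
        · rw [LinearMap.comp_apply, hpos _ _ hm', map_zero]
        · obtain ⟨k', rfl, hk'⟩ := hrank _ _ hm' hlt
          change 2 * k' + (ε' : ℕ) < 2 * k + 1 at hk'
          rcases lt_or_eq_of_le (show k' ≤ k by omega) with hlt' | rfl
          · simp only [LinearMap.comp_apply, LinearMap.sub_apply, LinearMap.smul_apply,
              LinearMap.proj_apply]
            rw [hlow k k' ε' _ hlt' le_rfl, hlow k k' ε' _ hlt' (by omega), smul_zero, sub_zero]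
          · obtain rfl : ε' = 0 := Fin.ext (by simp; omega)
            rw [LinearMap.comp_apply, hneg0]
            simp [hne]

/-! ### The action of `Y` and `Z` on the test vectors -/

theorem elY_eq_zero (h : ActsOnPairs q c u₁ V0 V1 T) {φ : Fin 2 → ℤ → ℂ} (hφ : φ 0 = 0) :
    elY V0 T φ = 0 := by
  ext i j
  fin_cases i
  · simpa [hφ] using h.elY_zero φ j
  · simpa [hφ] using h.elY_one φ j

/-- The only possible contribution is at `j = 0`, where the factor `1 - q ^ j` vanishes. -/
theorem elZ_cyclicVec (h : ActsOnPairs q c u₁ V0 V1 T) : elZ u₁ V0 T cyclicVec = 0 := by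
  ext i j
  fin_cases i
  · exact h.elZ_zero _ j
  · refine (h.elZ_one _ j).trans ?_
    rcases eq_or_ne j 0 with rfl | hj
    · simp [cyclicVec]
    · simp [cyclicVec, hj]

theorem elZ_mul_elY (h : ActsOnPairs q c u₁ V0 V1 T) : elZ u₁ V0 T * elY V0 T = 0 := by
  refine LinearMap.ext fun φ => funext fun i => funext fun j => ?_
  fin_cases i
  · exact h.elZ_zero _ j
  · refine (h.elZ_one _ j).trans ?_
    change _ = (0 : ℂ)
    rw [h.elY_zero, h.elY_zero, h.elY_one, sub_add_cancel, add_sub_cancel_right]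
    ring

/-- On first components `Y` sends `δ_{n+1}` to `-i (1 - q ^ (n + 1)) δ_n`, a nonzero multiple. At
`δ₀` the first component dies and the second becomes a multiple of `δ₁`, so that exactly `n + 1`
steps reach `cyclicVec`. -/
theorem elY_pow_single (h : ActsOnPairs q c u₁ V0 V1 T) (hroot : ∀ m : ℕ, 0 < m → q ^ m ≠ 1)
    (n : ℕ) {a : ℂ} (ha : a ≠ 0) {φ : Fin 2 → ℤ → ℂ} (hφ : φ 0 = a • Pi.single (n : ℤ) 1) :
    ∃ b : ℂ, b ≠ 0 ∧ (elY V0 T ^ (n + 1)) φ = b • cyclicVec := by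
  induction n generalizing a φ with
  | zero =>
    refine ⟨-Complex.I * a, mul_ne_zero (neg_ne_zero.2 Complex.I_ne_zero) ha, ?_⟩
    rw [zero_add, pow_one]
    ext i j
    fin_cases i
    · refine (h.elY_zero φ j).trans ?_
      rcases eq_or_ne (j + 1) 0 with hj | hj
      · simp [hj, cyclicVec]
      · simp [hφ, hj, cyclicVec]
    · refine (h.elY_one φ j).trans ?_
      rcases eq_or_ne j 0 with rfl | hj
      · simp [hφ, cyclicVec]
      · simp [hφ, hj, cyclicVec, Pi.single_apply, sub_eq_zero]
  | succ n ih =>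
    have h1 : elY V0 T φ 0 = (-Complex.I * (1 - q ^ (n + 1)) * a) • Pi.single (n : ℤ) 1 := by
      ext j
      rw [h.elY_zero, hφ]
      rcases eq_or_ne j n with rfl | hj
      · have : q ^ ((n : ℤ) + 1) = q ^ (n + 1) := by exact_mod_cast zpow_natCast q (n + 1)
        simp [this]
      · simp [hj]
    obtain ⟨b, hb, hb'⟩ := ih (mul_ne_zero (mul_ne_zero (neg_ne_zero.2 Complex.I_ne_zero)
      (sub_ne_zero.2 (hroot (n + 1) n.succ_pos).symm)) ha) h1
    exact ⟨b, hb, by rw [pow_succ, Module.End.mul_apply, hb']⟩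

theorem elZ_pow_single (h : ActsOnPairs q c u₁ V0 V1 T) (hroot : ∀ m : ℕ, 0 < m → q ^ m ≠ 1)
    (n : ℕ) {a : ℂ} (ha : a ≠ 0) {φ : Fin 2 → ℤ → ℂ} (hφ0 : φ 0 = 0)
    (hφ : φ 1 = a • Pi.single (n + 1 : ℤ) 1) :
    ∃ b : ℂ, b ≠ 0 ∧ (elZ u₁ V0 T ^ n) φ = b • cyclicVec := by
  induction n generalizing a φ with
  | zero =>
    refine ⟨a, ha, ?_⟩
    ext i j
    fin_cases i
    · simp [hφ0, cyclicVec]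
    · simp [hφ, cyclicVec]
  | succ n ih =>
    have h1 : elZ u₁ V0 T φ 1 =
        (-Complex.I * (1 - q ^ (n + 1)) * a) • Pi.single (n + 1 : ℤ) 1 := by
      ext j
      rw [h.elZ_one, hφ, hφ0]
      rcases eq_or_ne j (n + 1) with rfl | hj
      · have : q ^ ((n : ℤ) + 1) = q ^ (n + 1) := by exact_mod_cast zpow_natCast q (n + 1)
        simp [this]
        ring
      · simp [hj]
    obtain ⟨b, hb, hb'⟩ := ih (mul_ne_zero (mul_ne_zero (neg_ne_zero.2 Complex.I_ne_zero)
      (sub_ne_zero.2 (hroot (n + 1) n.succ_pos).symm)) ha) (funext fun j => h.elZ_zero φ j) h1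
    exact ⟨b, hb, by rw [pow_succ, Module.End.mul_apply, hb']⟩

theorem twoSidedPow_testVec (h : ActsOnPairs q c u₁ V0 V1 T)
    (hroot : ∀ m : ℕ, 0 < m → q ^ m ≠ 1) (n : ℤ) :
    ∃ b : ℂ, b ≠ 0 ∧
      twoSidedPow (elY V0 T) (elZ u₁ V0 T) n (testVec (elY V0 T) n) = b • cyclicVec := by
  by_cases hn : 0 ≤ n
  · lift n to ℕ using hn
    rw [twoSidedPow_natCast, testVec, if_pos (Int.natCast_nonneg n), ← Module.End.mul_apply,
      ← pow_succ]
    exact h.elY_pow_single hroot n one_ne_zero (by simp)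
  · obtain ⟨k, rfl⟩ : ∃ k : ℕ, n = -(k : ℤ) := ⟨(-n).toNat, by omega⟩
    rw [twoSidedPow_neg_natCast, testVec, if_neg hn]
    exact h.elZ_pow_single hroot k one_ne_zero rfl (by simp [add_comm])

theorem twoSidedPow_testVec_eq_zero (h : ActsOnPairs q c u₁ V0 V1 T)
    (hroot : ∀ m : ℕ, 0 < m → q ^ m ≠ 1) {n k : ℤ} (hkn : k.natAbs ≤ n.natAbs) (hne : n ≠ k) :
    twoSidedPow (elY V0 T) (elZ u₁ V0 T) n (testVec (elY V0 T) k) = 0 := by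
  have hYw : elY V0 T cyclicVec = 0 := h.elY_eq_zero rfl
  by_cases hk : 0 ≤ k
  · lift k to ℕ using hk
    rw [testVec, if_pos (Int.natCast_nonneg k)]
    by_cases hn : 0 ≤ n
    · lift n to ℕ using hn
      obtain ⟨d, rfl⟩ : ∃ d, n = d + 1 + k := ⟨n - k - 1, by omega⟩
      obtain ⟨b, -, hb⟩ := h.elY_pow_single (φ := ![Pi.single (k : ℤ) 1, 0]) hroot k one_ne_zero
        (by simp)
      rw [twoSidedPow_natCast, ← Module.End.mul_apply, ← pow_succ,
        show d + 1 + k + 1 = d + 1 + (k + 1) by ring, pow_add, Module.End.mul_apply, hb, map_smul,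
        pow_succ, Module.End.mul_apply, hYw, map_zero, smul_zero]
    · obtain ⟨d, rfl⟩ : ∃ d : ℕ, n = -((d + 1 : ℕ) : ℤ) := ⟨(-n).toNat - 1, by omega⟩
      rw [twoSidedPow_neg_natCast, ← Module.End.mul_apply, pow_succ, mul_assoc, h.elZ_mul_elY,
        mul_zero, LinearMap.zero_apply]
  · obtain ⟨b, rfl⟩ : ∃ b : ℕ, k = -(b : ℤ) := ⟨(-k).toNat, by omega⟩
    rw [testVec, if_neg hk]
    by_cases hn : 0 ≤ n
    · obtain ⟨d, rfl⟩ : ∃ d : ℕ, n = ((d + 1 : ℕ) : ℤ) := ⟨n.toNat - 1, by omega⟩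
      rw [twoSidedPow_natCast, pow_succ, Module.End.mul_apply, h.elY_eq_zero rfl, map_zero]
    · obtain ⟨d, rfl⟩ : ∃ d : ℕ, n = -((d + 1 + b : ℕ) : ℤ) :=
        ⟨(-n).toNat - b - 1, by omega⟩
      obtain ⟨b', -, hb⟩ := h.elZ_pow_single (φ := ![0, Pi.single (1 - -(b : ℤ)) 1]) hroot b
        one_ne_zero rfl (by simp [add_comm])
      rw [twoSidedPow_neg_natCast, pow_add, Module.End.mul_apply, hb, map_smul, pow_succ,
        Module.End.mul_apply, h.elZ_cyclicVec, map_zero, smul_zero]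

theorem linearIndependent_normalWord (h : ActsOnPairs q c u₁ V0 V1 T) (hq : q ≠ 0) (hc : c ≠ 0)
    (hroot : ∀ m : ℕ, 0 < m → q ^ m ≠ 1) :
    LinearIndependent ℂ fun w : ℤ × Fin 2 × ℤ => normalWord u₁ V0 V1 T w.1 w.2.1 w.2.2 := by
  have h1 := linearIndependent_mul_of_triangular Int.natAbs (testVec (elY V0 T))
    (h.linearIndependent_cyclicVec hq hc) (h.twoSidedPow_testVec hroot)
    (fun _ _ => h.twoSidedPow_testVec_eq_zero hroot)
  exact h1.comp (Equiv.prodAssoc ℤ (Fin 2) ℤ).symm (Equiv.injective _)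

end ActsOnPairs

end

end ConfluentPIV

theorem mainTheorem3 (q r u₀ u₁ : ℂ) (hr : r ^ 2 = q) (hq : q ≠ 0)
    (hroot : ∀ m : ℕ, 0 < m → q ^ m ≠ 1) (hu₀ : u₀ ≠ 0) (hu₁ : u₁ ≠ 0) :
    ConfluentPIV.HRelations q r u₀ u₁
        (ConfluentPIV.matV0 q r u₀) (ConfluentPIV.matV1 q r u₀)
        (ConfluentPIV.matV0c q r u₀ u₁) (ConfluentPIV.matV1c q r u₀ u₁) ∧
    ∃ Φ : ConfluentPIV.HIV q r u₀ u₁ →ₐ[ℂ]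
        Matrix (Fin 2) (Fin 2) (ConfluentPIV.QTorus q r u₀),
      Φ (ConfluentPIV.gen q r u₀ u₁ ConfluentPIV.HGen.V0) = ConfluentPIV.matV0 q r u₀ ∧
      Φ (ConfluentPIV.gen q r u₀ u₁ ConfluentPIV.HGen.V1) = ConfluentPIV.matV1 q r u₀ ∧
      Φ (ConfluentPIV.gen q r u₀ u₁ ConfluentPIV.HGen.V0c) = ConfluentPIV.matV0c q r u₀ u₁ ∧
      Φ (ConfluentPIV.gen q r u₀ u₁ ConfluentPIV.HGen.V1c) = ConfluentPIV.matV1c q r u₀ u₁ ∧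
      LinearIndependent ℂ (fun w : ℤ × Fin 2 × ℤ =>
        Φ (ConfluentPIV.word q r u₀ u₁ w.1 w.2.1 w.2.2)) ∧
      Function.Injective Φ := by
  have hr0 : r ≠ 0 := by rintro rfl; exact hq (by simpa using hr.symm)
  have hM := ConfluentPIV.mat_relations u₁ hr hq hu₀ hu₁
  obtain ⟨Φ, h0, h1, h0c, h1c⟩ := hM.exists_algHom
  have hLI : LinearIndependent ℂ (fun w : ℤ × Fin 2 × ℤ =>
      Φ (ConfluentPIV.word q r u₀ u₁ w.1 w.2.1 w.2.2)) := by
    have h2 := (ConfluentPIV.matRep_actsOnPairs hq hr0 hu₀ u₁).linearIndependent_normalWord hq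
      (inv_ne_zero (mul_ne_zero hr0 hu₀)) hroot
    have h3 := fun w : ℤ × Fin 2 × ℤ =>
      ConfluentPIV.map_word ((ConfluentPIV.matRep hq hr0 hu₀).comp Φ) w.1 w.2.1 w.2.2
    simp only [AlgHom.comp_apply, h0, h1, h1c] at h3
    simp only [← h3] at h2
    -- Independence of the operators pulls back along `matRep` to the matrices; faithfulness of the
    -- representation is not needed.
    exact LinearIndependent.of_comp (ConfluentPIV.matRep hq hr0 hu₀).toLinearMap h2
  exact ⟨hM, Φ, h0, h1, h0c, h1c, hLI,
    ConfluentPIV.injective_of_linearIndependent_word hu₁ hq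
      (mul_ne_zero hr0 (inv_ne_zero hu₀)) Φ hLI⟩
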